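/- **Theorem.** All metric spaces called Polish are complete and separable. Let $B$ be a Polish metric space. A *compact $mm$-field* over $B$ is a triple $\mathcal X=(X,\pi_X,\mu_X)$ with $X$ a compact metric space, $\pi_X\colon X\to B$ a $1$-Lipschitz map and $\mu_X$ a Borel probability measure on $X$. Two such fields are *isometric* if there is a bijective isometry $\phi\colon X\to Y$ with $\pi_Y\circ\phi=\pi_X$ and $\phi_*\mu_X=\mu_Y$. Put $$d_{GW,\infty}(\mathcal X,\mathcal Y)=\inf_{P}\max\Big\{\tfrac12\sup_{\mathrm{supp}(P\otimes P)}|d_X(x,x')-d_Y(y,y')|,\ \sup_{\mathrm{supp}P}d_B(\pi_X(x),\pi_Y(y))\Big\},$$ the infimum being over all couplings $P$ of $\mu_X$ and $\mu_Y$. Let $\mathcal M_B$ be the set of isometry classes of compact $mm$-fields over $B$, and let $\mathcal I_B\subseteq\mathcal M_B$ be the set of classes of those with $\mathrm{supp}\,\mu_X=X$. Let $\pi\colon U\to B$ be a Urysohn field over $B$: $U$ is a Polish metric space, $\pi$ is $1$-Lipschitz, and for every finite $A\subseteq U$, every one-point metric extension $A^*=A\sqcup\{a^*\}$ and every $1$-Lipschitz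 $\phi\colon A^*\to B$ with $\phi|_A=\pi|_A$, there is an isometric embedding $\imath\colon A^*\to U$ with $\imath|_A$ the inclusion and $\pi\circ\imath=\phi$. Let $\mathcal G_B$ be the group of bijective isometries $g\colon U\to U$ with $\pi\circ g=\pi$. Let $\mathcal L_B$ be the set of Borel probability measures on $U$ with compact support, with $d_{W,\infty}(\mu,\nu)=\inf_P\sup_{(u,v)\in\mathrm{supp}P}d_U(u,v)$ over couplings $P$ of $\mu,\nu$. The group $\mathcal G_B$ acts on $\mathcal L_B$ by $g\cdot\mu=g_*\mu$. Let $d$ be the quotient metric on $\mathcal L_B/\mathcal G_B$, that is, the largest pseudo-metric for which $\mathcal L_B\to\mathcal L_B/\mathcal G_B$ is $1$-Lipschitz. Then: 1. $d_{GW,\infty}$ is a well-defined pseudo-metric on $\mathcal M_B$, $d$ is a metric on $\mathcal L_B/\mathcal G_B$, and $$d([\mu],[\nu])=\inf_{g\in\mathcal G_B}d_{W,\infty}(\mu,g_*\nu).$$ 2. Every compact $mm$-field $\mathcal X$ over $B$ admits an isometric embedding $\iota\colon X\to U$ with $\pi\circ\iota=\pi_X$, and $[\mathcal X]\mapsto[\iota_*\mu_X]$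 is a well-defined map $\Psi\colon\mathcal M_B\to\mathcal L_B/\mathcal G_B$, independent of the choice of $\iota$. It is distance-preserving (for $d_{GW,\infty}$ and $d$) and surjective. 3. $\Psi$ restricts to a bijective isometry from $(\mathcal I_B,d_{GW,\infty})$ onto $(\mathcal L_B/\mathcal G_B,d)$. In particular $d_{GW,\infty}$ is a metric on $\mathcal I_B$. -/

import Mathlib

open MeasureTheory Set
open scoped ENNReal

universe u

noncomputable section

/-! Here "Polish" means that the given metric is complete and separable. -/

/-- `π : U → B` is a Urysohn field over `B`: it is `1`-Lipschitz, and whenever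
`E = j(A) ⊔ {p}` is a one-point metric extension of a finite subspace `A ⊆ U` and
`φ : E → B` is a `1`-Lipschitz map extending `π|_A`, there is an isometric embedding
`ι : E → U` over `B` that restricts to the inclusion on `A`. -/
structure IsUrysohnField {B U : Type u} [MetricSpace B] [MetricSpace U] (π : U → B) :
    Prop where
  lipschitz : LipschitzWith 1 π
  extension : ∀ A : Set U, A.Finite →
    ∀ (E : Type u) [MetricSpace E] (j : A → E) (p : E),
      Isometry j → p ∉ range j → range j ∪ {p} = univ →
      ∀ φ : E → B, LipschitzWith 1 φ → (∀ a : A, φ (j a) = π a) →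
        ∃ ι : E → U, Isometry ι ∧ (∀ a : A, ι (j a) = a) ∧ ∀ z, π (ι z) = φ z

/-- A metric-measure field over `B`: a `1`-Lipschitz map from a Polish metric space to `B`
together with a Borel probability measure on the domain. -/
structure MMField (B : Type u) [MetricSpace B] where
  carrier : Type u
  [metricSpace : MetricSpace carrier]
  [completeSpace : CompleteSpace carrier]
  [separableSpace : TopologicalSpace.SeparableSpace carrier]
  [measurableSpace : MeasurableSpace carrier]
  [borelSpace : BorelSpace carrier]
  proj : carrier → B
  lipschitz_proj : LipschitzWith 1 proj
  law : ProbabilityMeasure carrier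

attribute [instance] MMField.metricSpace MMField.completeSpace MMField.separableSpace
  MMField.measurableSpace MMField.borelSpace

/-- The couplings of two measures. -/
def couplings {X Y : Type u} [MeasurableSpace X] [MeasurableSpace Y]
    (μ : Measure X) (ν : Measure Y) : Set (Measure (X × Y)) :=
  {P | P.map Prod.fst = μ ∧ P.map Prod.snd = ν}

/-- The `∞`-Wasserstein distance of two Borel measures on a metric space. -/
def dWInf {U : Type u} [MetricSpace U] [MeasurableSpace U] (μ ν : Measure U) : ℝ≥0∞ :=
  ⨅ P ∈ couplings μ ν, ⨆ z ∈ P.support, edist z.1 z.2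

/-- The `∞`-Gromov-Wasserstein distance of two metric-measure fields over `B`. -/
def dGWInf {B : Type u} [MetricSpace B] (X Y : MMField B) : ℝ≥0∞ :=
  ⨅ P ∈ couplings (X.law : Measure X.carrier) (Y.law : Measure Y.carrier),
    max
      ((⨆ z ∈ (P.prod P).support,
        ENNReal.ofReal |dist z.1.1 z.2.1 - dist z.1.2 z.2.2|) / 2)
      (⨆ z ∈ P.support, edist (X.proj z.1) (Y.proj z.2))

/-- Isometry of metric-measure fields: a measure-preserving bijective isometry of the
domains over `B`. -/
def MMField.Isometric {B : Type u} [MetricSpace B] (X Y : MMField B) : Prop :=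
  ∃ e : X.carrier ≃ᵢ Y.carrier, (∀ x, Y.proj (e x) = X.proj x) ∧
    (X.law : Measure X.carrier).map e = Y.law

theorem MMField.isometric_equivalence {B : Type u} [MetricSpace B] :
    Equivalence (MMField.Isometric (B := B)) where
  refl X := ⟨IsometryEquiv.refl _, fun _ => rfl, Measure.map_id⟩
  symm := by
    rintro X Y ⟨e, h1, h2⟩
    refine ⟨e.symm, fun y => ?_, ?_⟩
    · rw [← h1, e.apply_symm_apply]
    · rw [← h2, Measure.map_map e.symm.continuous.measurable e.continuous.measurable]
      have : (e.symm : Y.carrier → X.carrier) ∘ e = id := by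
        funext x; simp
      rw [this, Measure.map_id]
  trans := by
    rintro X Y Z ⟨e, h1, h2⟩ ⟨f, h3, h4⟩
    refine ⟨e.trans f, fun x => ?_, ?_⟩
    · rw [IsometryEquiv.trans_apply, h3, h1]
    · rw [← h4, ← h2, Measure.map_map f.continuous.measurable e.continuous.measurable]
      rfl

/-- Metric-measure fields with compact domain. -/
def CompactMMField (B : Type u) [MetricSpace B] : Type (u + 1) :=
  {X : MMField B // CompactSpace X.carrier}

/-- Isometry of compact metric-measure fields as an equivalence relation. -/
def compactMMFieldSetoid (B : Type u) [MetricSpace B] : Setoid (CompactMMField B) where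
  r X Y := X.1.Isometric Y.1
  iseqv := ⟨fun X => MMField.isometric_equivalence.refl X.1,
    fun h => MMField.isometric_equivalence.symm h,
    fun h k => MMField.isometric_equivalence.trans h k⟩

/-- The isometry classes of compact metric-measure fields over `B`. -/
def Moduli (B : Type u) [MetricSpace B] : Type (u + 1) :=
  Quotient (compactMMFieldSetoid B)

/-- The isometry class of a compact metric-measure field. -/
def Moduli.mk {B : Type u} [MetricSpace B] (X : CompactMMField B) : Moduli B :=
  Quotient.mk (compactMMFieldSetoid B) X

/-- The isometry classes of the compact metric-measure fields whose measure has full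
support. -/
def fullySupportedModuli (B : Type u) [MetricSpace B] : Set (Moduli B) :=
  {c | ∃ X : CompactMMField B,
    (X.1.law : Measure X.1.carrier).support = univ ∧ Moduli.mk X = c}

section Laws

/-- The automorphism group of `π : U → B`: bijective isometries `g` of `U` with
`π ∘ g = π`. -/
def fieldAut {B U : Type u} [MetricSpace U] (π : U → B) : Subgroup (U ≃ᵢ U) where
  carrier := {g | ∀ x, π (g x) = π x}
  one_mem' := fun _ => rfl
  mul_mem' := by
    intro g h hg hh x
    rw [IsometryEquiv.mul_apply, hg, hh]
  inv_mem' := by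
    intro g hg x
    rw [← hg (g⁻¹ x), IsometryEquiv.apply_inv_self]

/-- The compactly supported laws on `U`: Borel probability measures with compact support. -/
def CompactLaw (U : Type u) [MetricSpace U] [MeasurableSpace U] : Type u :=
  {μ : ProbabilityMeasure U // IsCompact (μ : Measure U).support}

/-- The pushforward of a law along a continuous map is supported in the image of any compact
set that carries the law. -/
theorem isCompact_support_map {X U : Type u} [MetricSpace X] [MeasurableSpace X]
    [BorelSpace X] [MetricSpace U] [MeasurableSpace U] [BorelSpace U]
    (μ : Measure X) {f : X → U} (hf : Continuous f) {K : Set X} (hK : IsCompact K)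
    (hKμ : K ∈ ae μ) : IsCompact (μ.map f).support := by
  have hfK : IsCompact (f '' K) := hK.image hf
  refine hfK.of_isClosed_subset Measure.isClosed_support
    (Measure.support_subset_of_isClosed hfK.isClosed ?_)
  rw [mem_ae_iff, Measure.map_apply hf.measurable hfK.isClosed.measurableSet.compl]
  refine measure_mono_null ?_ (mem_ae_iff.1 hKμ)
  intro x hx hxK
  exact hx (mem_image_of_mem f hxK)

variable {B U : Type u} [MetricSpace B] [MetricSpace U]
  [TopologicalSpace.SeparableSpace U] [MeasurableSpace U] [BorelSpace U]

/-- The pushforward `g_* μ` of a compactly supported law along an isometry of `U`. -/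
def CompactLaw.map (g : U ≃ᵢ U) (μ : CompactLaw U) : CompactLaw U :=
  ⟨μ.1.map g.continuous.measurable.aemeasurable, by
    have : SecondCountableTopology U := UniformSpace.secondCountable_of_separable U
    exact isCompact_support_map _ g.continuous μ.2 Measure.support_mem_ae⟩

/-- Automorphisms act on compactly supported laws by pushforward. -/
instance CompactLaw.mulAction (π : U → B) : MulAction (fieldAut π) (CompactLaw U) where
  smul g μ := CompactLaw.map g.1 μ
  one_smul μ := by
    apply Subtype.ext
    apply Subtype.ext
    exact Measure.map_id
  mul_smul g h μ := by
    apply Subtype.ext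
    apply Subtype.ext
    exact (Measure.map_map g.1.continuous.measurable h.1.continuous.measurable).symm

/-- The orbit space of compactly supported laws under the automorphism group of `π`. -/
def LawOrbits (π : U → B) : Type u :=
  MulAction.orbitRel.Quotient (fieldAut π) (CompactLaw U)

/-- The orbit of a compactly supported law. -/
def LawOrbits.mk (π : U → B) (μ : CompactLaw U) : LawOrbits π :=
  Quotient.mk (MulAction.orbitRel (fieldAut π) (CompactLaw U)) μ

/-- `ι` is an isometric embedding of the field underlying `X` into `π : U → B` over `B`. -/
structure IsFieldEmbedding (X : MMField B) (π : U → B) (ι : X.carrier → U) : Prop where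
  isometry : Isometry ι
  comm : ∀ x, π (ι x) = X.proj x

/-- The law `ι_* μ_X` on `U` for an isometric embedding `ι` of a compact metric-measure
field `X`. -/
def embeddedLaw (X : CompactMMField B) (π : U → B) (ι : X.1.carrier → U)
    (hι : IsFieldEmbedding X.1 π ι) : CompactLaw U :=
  ⟨X.1.law.map hι.isometry.continuous.measurable.aemeasurable, by
    have : CompactSpace X.1.carrier := X.2
    exact isCompact_support_map _ hι.isometry.continuous isCompact_univ Filter.univ_mem⟩

end Laws

/-- The quotient (extended pseudo-)metric of a distance function `d` along a surjection
`q : L → Q`: the largest pseudo-metric on `Q` for which `q` is `1`-Lipschitz. -/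
def quotientEDist {L Q : Type u} (d : L → L → ℝ≥0∞) (q : L → Q) (a b : Q) : ℝ≥0∞ :=
  ⨆ (m : PseudoEMetricSpace Q) (_ : ∀ x y : L, m.edist (q x) (q y) ≤ d x y), m.edist a b

end

/-! The heart of the matter is that $d_{GW,\infty}(\mathcal X,\mathcal Y)$ equals the distance
between the orbits of the laws of $\mathcal X$ and $\mathcal Y$ embedded in $U$
(`IsUrysohnField.orbitEDist_eq_dGWInf`).

Completeness of $U$ upgrades the one-point extension property from finite to compact sets. Inserting
points one at a time then embeds every separable space over $B$, and going back and forth extends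
every isometry over $B$ between compact subsets of $U$ to an automorphism
(`IsUrysohnField.exists_fieldAut`). Hence two embeddings of a compact field differ by an
automorphism, and $\Psi$ is well defined.

A coupling of two embedded laws pulls back to the fields, and the triangle inequality bounds its
Gromov-Wasserstein cost. Conversely, a coupling of cost below $r$ allows $X$ and $Y$ to be glued so
that coupled points have distance $r$; embedding the glued space makes the two laws $r$-close.

The group acts by isometries, so the distance between orbits is the quotient metric. It separates
orbits: if $g_n\nu\to\mu$, the restrictions of $g_n$ to the compact support of $\nu$ have a
pointwise limit along an ultrafilter, and homogeneity extends this limit to an automorphism taking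
$\nu$ to $\mu$.

Restricting $\pi$ to the support of a law gives a fully supported preimage. It is unique up to
isometry because the support of the embedded law is the whole image of the field. -/

noncomputable section

open Filter Topology

/-! ### One-point extensions over compact sets. -/

section Geometry

/-- A Katetov function `f` on a set `K`, together with a compatible point `b` of the base:
the data of a one-point extension of `K` over `B`. -/
structure IsKatetovOn {B U : Type*} [MetricSpace B] [MetricSpace U] (π : U → B) (K : Set U)
    (f : U → ℝ) (b : B) : Prop where
  le_add_dist : ∀ x ∈ K, ∀ y ∈ K, f x ≤ f y + dist x y
  dist_le : ∀ x ∈ K, ∀ y ∈ K, dist x y ≤ f x + f y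
  dist_proj_le : ∀ x ∈ K, dist (π x) b ≤ f x

theorem IsKatetovOn.nonneg {B U : Type*} [MetricSpace B] [MetricSpace U] {π : U → B}
    {K : Set U} {f : U → ℝ} {b : B} (h : IsKatetovOn π K f b) {x : U} (hx : x ∈ K) :
    0 ≤ f x :=
  dist_nonneg.trans (h.dist_proj_le x hx)

theorem IsKatetovOn.mono {B U : Type*} [MetricSpace B] [MetricSpace U] {π : U → B}
    {K A : Set U} {f : U → ℝ} {b : B} (h : IsKatetovOn π K f b) (hA : A ⊆ K) :
    IsKatetovOn π A f b :=
  ⟨fun x hx y hy => h.le_add_dist x (hA hx) y (hA hy),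
    fun x hx y hy => h.dist_le x (hA hx) y (hA hy), fun x hx => h.dist_proj_le x (hA hx)⟩

/-- Both `dist u ·` and `f` are $1$-Lipschitz on `K` and they agree at `y`, so the error at `x` is
at most twice the distance. -/
theorem IsKatetovOn.abs_dist_sub_le {B U : Type*} [MetricSpace B] [MetricSpace U] {π : U → B}
    {K : Set U} {f : U → ℝ} {b : B} (h : IsKatetovOn π K f b) {x y : U} (hx : x ∈ K)
    (hy : y ∈ K) (u : U) (hu : dist u y = f y) :
    |dist u x - f x| ≤ 2 * dist x y := by
  have h1 := h.le_add_dist x hx y hy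
  have h2 := h.le_add_dist y hy x hx
  have h3 := dist_triangle u x y
  have h4 := dist_triangle u y x
  rw [dist_comm y x] at *
  rw [abs_le]
  constructor <;> linarith

/-- The one-point metric extension of `A` defined by a positive Katetov function. -/
@[reducible] def onePointMetric {A : Type*} [MetricSpace A] (f : A → ℝ) (pos : ∀ x, 0 < f x)
    (h1 : ∀ x y, f x ≤ f y + dist x y) (h2 : ∀ x y, dist x y ≤ f x + f y) :
    MetricSpace (Option A) where
  dist
    | none, none => 0
    | none, some x => f x
    | some x, none => f x
    | some x, some y => dist x y
  dist_self x := by cases x <;> simp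
  dist_comm x y := by cases x <;> cases y <;> simp [dist_comm]
  dist_triangle x y z := by
    cases x <;> cases y <;> cases z <;> simp only [add_zero, zero_add, le_refl]
    · linarith [pos ‹_›]
    · rename_i y z
      have := h1 z y
      rw [dist_comm] at this
      exact this
    · exact h2 _ _
    · rename_i y z
      have := h1 y z
      linarith
    · exact dist_triangle _ _ _
  eq_of_dist_eq_zero {x y} h := by
    cases x <;> cases y <;> simp only [Option.some.injEq, reduceCtorEq] at h ⊢
    · exact absurd h (pos _).ne'
    · exact absurd h (pos _).ne'
    · exact eq_of_dist_eq_zero h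

section Extension

variable {B U : Type u} [MetricSpace B] [MetricSpace U] {π : U → B}

theorem IsUrysohnField.exists_dist_eq_of_finite (hπ : IsUrysohnField π) {A : Set U}
    (hA : A.Finite) {f : U → ℝ} {b : B} (hf : IsKatetovOn π A f b) :
    ∃ u, (∀ a ∈ A, dist u a = f a) ∧ π u = b := by
  -- A zero of `f` at `a` forces `f` to be the distance to `a` and `π a = b`, so `a` is the required
  -- point. Otherwise `f` is positive and defines a genuinely new point.
  by_cases h0 : ∃ a ∈ A, f a = 0
  · obtain ⟨a, ha, hfa⟩ := h0
    refine ⟨a, fun x hx => ?_, ?_⟩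
    · have h1 := hf.le_add_dist x hx a ha
      have h2 := hf.dist_le x hx a ha
      rw [dist_comm]
      linarith
    · have := hf.dist_proj_le a ha
      rw [hfa] at this
      exact dist_le_zero.1 this
  · push Not at h0
    let f' : A → ℝ := fun a => f a
    let : MetricSpace (Option A) := onePointMetric f'
      (fun a => lt_of_le_of_ne (hf.nonneg a.2) (Ne.symm (h0 a a.2)))
      (fun a c => hf.le_add_dist a a.2 c c.2) (fun a c => hf.dist_le a a.2 c c.2)
    have hds : ∀ x y : A, dist (some x) (some y) = dist x y := fun _ _ => rfl
    have hdn : ∀ x : A, dist (none : Option A) (some x) = f x := fun _ => rfl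
    have hdn' : ∀ x : A, dist (some x) (none : Option A) = f x := fun _ => rfl
    obtain ⟨ι, hι, hιA, hιφ⟩ := hπ.extension A hA (Option A) some none
      (Isometry.of_dist_eq hds) (by simp)
      (by ext z; cases z <;> simp)
      (fun z => z.elim b fun a => π a)
      (by
        refine LipschitzWith.of_dist_le_mul fun x y => ?_
        cases x <;> cases y <;> simp only [Option.elim, NNReal.coe_one, one_mul]
        · simp
        · rw [hdn, dist_comm]; exact hf.dist_proj_le _ (Subtype.coe_prop _)
        · rw [hdn']; exact hf.dist_proj_le _ (Subtype.coe_prop _)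
        · rw [hds, Subtype.dist_eq]
          simpa using hπ.lipschitz.dist_le_mul _ _)
      (fun a => rfl)
    refine ⟨ι none, fun a ha => ?_, hιφ none⟩
    have := hι.dist_eq none (some ⟨a, ha⟩)
    rw [hιA, hdn] at this
    exact this

theorem IsKatetovOn.exists_finite_net {K : Set U} (hK : IsCompact K) {f : U → ℝ} {b : B}
    (hf : IsKatetovOn π K f b) {ε : ℝ} (hε : 0 < ε) :
    ∃ A ⊆ K, A.Finite ∧ ∀ u : U, (∀ a ∈ A, dist u a = f a) → ∀ k ∈ K, |dist u k - f k| ≤ ε := by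
  obtain ⟨A, hAK, hA, hcov⟩ := hK.finite_cover_balls (half_pos hε)
  refine ⟨A, hAK, hA, fun u hu k hk => ?_⟩
  obtain ⟨a, ha, hka⟩ := mem_iUnion₂.1 (hcov hk)
  have := hf.abs_dist_sub_le hk (hAK ha) u (hu a ha)
  rw [Metric.mem_ball] at hka
  linarith

/-- The approximate solution `u` joins the finite net as a further point, and the new point is
required to lie close to it. Control of `dist u v` by the old error makes the iteration Cauchy. -/
theorem IsUrysohnField.exists_improve (hπ : IsUrysohnField π) {K : Set U} (hK : IsCompact K)
    {f : U → ℝ} {b : B} (hf : IsKatetovOn π K f b) {u : U} {δ : ℝ} (hδ : 0 ≤ δ)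
    (hu : ∀ k ∈ K, |dist u k - f k| ≤ δ) (hub : π u = b) {ε : ℝ} (hε : 0 < ε) :
    ∃ v, (∀ k ∈ K, |dist v k - f k| ≤ ε) ∧ π v = b ∧ dist u v ≤ δ := by
  classical
  obtain ⟨A, hAK, hA, hnet⟩ := hf.exists_finite_net hK hε
  have hfA := hf.mono hAK
  -- If `u` is in the net, its distance to the new point is already prescribed as `f u`, which the
  -- hypothesis at `k = u` bounds by `δ`.
  by_cases huA : u ∈ A
  · obtain ⟨v, hv, hvb⟩ := hπ.exists_dist_eq_of_finite hA hfA
    refine ⟨v, hnet v hv, hvb, ?_⟩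
    have := hu u (hAK huA)
    rw [dist_self, zero_sub, abs_neg] at this
    rw [dist_comm, hv u huA]
    exact (le_abs_self _).trans this
  -- The smallest value at `u` that extends `f` to a Katetov function on `A ∪ {u}`. For empty `A`
  -- this supremum is `0`.
  · set δ' : ℝ := ⨆ a : A, |dist u a - f a| with hδ'
    have hle : ∀ a ∈ A, |dist u a - f a| ≤ δ' := fun a ha =>
      le_ciSup (f := fun a : A => |dist u a - f a|)
        ⟨δ, by rintro _ ⟨a, rfl⟩; exact hu a (hAK a.2)⟩ ⟨a, ha⟩
    have hδ'δ : δ' ≤ δ := Real.iSup_le (fun a => hu a (hAK a.2)) hδ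
    have hδ'0 : 0 ≤ δ' := Real.iSup_nonneg fun a => abs_nonneg _
    have hub' : ∀ a ∈ A, δ' ≤ f a + dist u a := fun a ha => by
      refine Real.iSup_le (fun c => ?_) (add_nonneg (hfA.nonneg ha) dist_nonneg)
      have h1 := hfA.le_add_dist c c.2 a ha
      have h2 := hfA.dist_le c c.2 a ha
      have h3 := dist_triangle u a c
      have h4 := dist_triangle_left (c : U) a u
      rw [dist_comm a] at h3
      rw [abs_le]
      constructor <;> linarith
    have hne : ∀ a ∈ A, a ≠ u := fun a ha h => huA (h ▸ ha)
    obtain ⟨v, hv, hvb⟩ := hπ.exists_dist_eq_of_finite (hA.insert u)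
      (f := Function.update f u δ') (b := b) (by
        refine ⟨?_, ?_, ?_⟩
        · rintro x (rfl | hx) y (rfl | hy)
          · simp
          · rw [Function.update_self, Function.update_of_ne (hne y hy)]
            exact hub' y hy
          · rw [Function.update_self, Function.update_of_ne (hne x hx), dist_comm]
            linarith [(abs_le.1 (hle x hx)).1]
          · rw [Function.update_of_ne (hne x hx), Function.update_of_ne (hne y hy)]
            exact hfA.le_add_dist x hx y hy
        · rintro x (rfl | hx) y (rfl | hy)
          · simp [hδ'0]
          · rw [Function.update_self, Function.update_of_ne (hne y hy)]
            linarith [(abs_le.1 (hle y hy)).2]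
          · rw [Function.update_self, Function.update_of_ne (hne x hx), dist_comm]
            linarith [(abs_le.1 (hle x hx)).2]
          · rw [Function.update_of_ne (hne x hx), Function.update_of_ne (hne y hy)]
            exact hfA.dist_le x hx y hy
        · rintro x (rfl | hx)
          · simp [hub, hδ'0]
          · rw [Function.update_of_ne (hne x hx)]
            exact hfA.dist_proj_le x hx)
    refine ⟨v, hnet v fun a ha => ?_, hvb, ?_⟩
    · rw [hv a (mem_insert_of_mem _ ha), Function.update_of_ne (hne a ha)]
    · rw [dist_comm, hv u (mem_insert _ _), Function.update_self]
      exact hδ'δ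

/-- One-point extensions of compact subsets of a complete Urysohn field are realized. -/
theorem IsUrysohnField.exists_dist_eq_of_isCompact [CompleteSpace U] (hπ : IsUrysohnField π)
    {K : Set U} (hK : IsCompact K) {f : U → ℝ} {b : B} (hf : IsKatetovOn π K f b) :
    ∃ u, (∀ k ∈ K, dist u k = f k) ∧ π u = b := by
  -- Stage `n` has error at most $2^{-n}$, which also bounds the step to stage `n + 1`.
  let Q : ℕ → U → Prop := fun n u => (∀ k ∈ K, |dist u k - f k| ≤ 1 * (1 / 2) ^ n) ∧ π u = b
  obtain ⟨u₀, hu₀⟩ : ∃ u, Q 0 u := by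
    obtain ⟨A, hAK, hA, hnet⟩ := hf.exists_finite_net hK one_pos
    obtain ⟨v, hv, hvb⟩ := hπ.exists_dist_eq_of_finite hA (hf.mono hAK)
    exact ⟨v, by simpa using hnet v hv, hvb⟩
  have step : ∀ (n : ℕ) (u : U), ∃ v, Q n u → Q (n + 1) v ∧ dist u v ≤ 1 * (1 / 2) ^ n := by
    intro n u
    by_cases hu : Q n u
    · obtain ⟨v, h1, h2, h3⟩ := hπ.exists_improve hK hf (by positivity) hu.1 hu.2
        (ε := 1 * (1 / 2) ^ (n + 1)) (by positivity)
      exact ⟨v, fun _ => ⟨⟨h1, h2⟩, h3⟩⟩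
    · exact ⟨u, fun h => absurd h hu⟩
  choose F hF using step
  let s : ℕ → U := fun n => Nat.rec u₀ F n
  have hs : ∀ n, Q n (s n) := by
    intro n
    induction n with
    | zero => exact hu₀
    | succ n ih => exact (hF n (s n) ih).1
  have hc : CauchySeq s :=
    cauchySeq_of_le_geometric (1 / 2) 1 (by norm_num) fun n => (hF n (s n) (hs n)).2
  obtain ⟨u, hu⟩ := cauchySeq_tendsto_of_complete hc
  refine ⟨u, fun k hk => ?_, ?_⟩
  · have h1 : Tendsto (fun n => |dist (s n) k - f k|) atTop (𝓝 |dist u k - f k|) :=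
      ((hu.dist tendsto_const_nhds).sub tendsto_const_nhds).abs
    have h2 : Tendsto (fun n : ℕ => (1 : ℝ) * (1 / 2) ^ n) atTop (𝓝 (1 * 0)) :=
      (tendsto_pow_atTop_nhds_zero_of_lt_one (by norm_num) (by norm_num)).const_mul 1
    have h3 := le_of_tendsto_of_tendsto' h1 h2 fun n => (hs n).1 k hk
    rw [mul_zero] at h3
    exact sub_eq_zero.1 (abs_nonpos_iff.1 h3)
  · have h1 := (hπ.lipschitz.continuous.tendsto u).comp hu
    refine tendsto_nhds_unique h1 ?_
    exact tendsto_const_nhds.congr fun n => (hs n).2.symm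

end Extension

/-! ### Partial isometries, embeddings and homogeneity. -/

/-- A relation between two spaces over `B` that is the graph of an isometry over `B` between
subsets. -/
structure IsPartialIsometry {B X U : Type*} [MetricSpace X] [MetricSpace U] (φ : X → B)
    (π : U → B) (R : Set (X × U)) : Prop where
  dist_eq : ∀ p ∈ R, ∀ q ∈ R, dist p.1 q.1 = dist p.2 q.2
  comm : ∀ p ∈ R, φ p.1 = π p.2

namespace IsPartialIsometry

variable {B X U : Type*} [MetricSpace X] [MetricSpace U] {φ : X → B} {π : U → B}
  {R : Set (X × U)}

theorem swap (h : IsPartialIsometry φ π R) : IsPartialIsometry π φ (Prod.swap ⁻¹' R) :=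
  ⟨fun _ hp _ hq => (h.dist_eq _ hp _ hq).symm, fun _ hp => (h.comm _ hp).symm⟩

theorem iUnion {R : ℕ → Set (X × U)} (hR : ∀ n, IsPartialIsometry φ π (R n))
    (hmono : Monotone R) : IsPartialIsometry φ π (⋃ n, R n) := by
  refine ⟨fun p hp q hq => ?_, fun p hp => ?_⟩
  · obtain ⟨n, hn⟩ := mem_iUnion.1 hp
    obtain ⟨m, hm⟩ := mem_iUnion.1 hq
    exact (hR (max n m)).dist_eq p (hmono (le_max_left _ _) hn) q (hmono (le_max_right _ _) hm)
  · obtain ⟨n, hn⟩ := mem_iUnion.1 hp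
    exact (hR n).comm p hn

/-- A partial isometry with dense domain and complete codomain extends to an isometry. -/
theorem exists_isometry [CompleteSpace U] (h : IsPartialIsometry φ π R)
    (hd : Dense (Prod.fst '' R)) : ∃ g : X → U, Isometry g ∧ ∀ p ∈ R, g p.1 = p.2 := by
  have hs : ∀ x : Prod.fst '' R, ∃ y, ((x : X), y) ∈ R := by
    rintro ⟨_, ⟨p, hp, rfl⟩⟩
    exact ⟨p.2, hp⟩
  choose s hs using hs
  have hsi : Isometry s := Isometry.of_dist_eq fun x y => (h.dist_eq _ (hs x) _ (hs y)).symm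
  have hi : IsUniformInducing ((↑) : Prod.fst '' R → X) := isUniformInducing_val _
  have hdr : DenseRange ((↑) : Prod.fst '' R → X) := hd.denseRange_val
  let di := hi.isDenseInducing hdr
  have hext : ∀ x : Prod.fst '' R, di.extend s x = s x := fun x =>
    uniformly_extend_of_ind hi hdr hsi.uniformContinuous x
  have huc : UniformContinuous (di.extend s) :=
    uniformContinuous_uniformly_extend hi hdr hsi.uniformContinuous
  refine ⟨di.extend s, Isometry.of_dist_eq fun x y => ?_, ?_⟩
  · refine hdr.induction_on₂ (p := fun x y => dist (di.extend s x) (di.extend s y) = dist x y)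
      ?_ ?_ x y
    · exact isClosed_eq ((huc.continuous.comp continuous_fst).dist
        (huc.continuous.comp continuous_snd)) (continuous_fst.dist continuous_snd)
    · intro a b
      rw [hext, hext, hsi.dist_eq]
      rfl
  · intro p hp
    have h1 := hext ⟨p.1, mem_image_of_mem _ hp⟩
    refine h1.trans ?_
    have h2 := h.dist_eq _ (hs ⟨p.1, mem_image_of_mem _ hp⟩) _ hp
    simp only [dist_self] at h2
    exact dist_eq_zero.1 h2.symm

end IsPartialIsometry

/-- Dependent choice for a list of requirements: `G n` is met by enlarging at step `n`, hence is
recorded for `R (n + 1)`. -/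
theorem exists_chain {α : Type*} {S : Set α → Prop} {G : ℕ → Set α → Prop}
    (step : ∀ n R, S R → ∃ R', S R' ∧ R ⊆ R' ∧ G n R') {R₀ : Set α} (h₀ : S R₀) :
    ∃ R : ℕ → Set α, R 0 = R₀ ∧ Monotone R ∧ (∀ n, S (R n)) ∧ ∀ n, G n (R (n + 1)) := by
  have step' : ∀ n R, ∃ R', S R → S R' ∧ R ⊆ R' ∧ G n R' := fun n R => by
    by_cases h : S R
    · obtain ⟨R', h'⟩ := step n R h
      exact ⟨R', fun _ => h'⟩
    · exact ⟨R, fun h' => absurd h' h⟩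
  choose F hF using step'
  let s : ℕ → Set α := fun n => Nat.rec R₀ F n
  have hs : ∀ n, S (s n) := by
    intro n
    induction n with
    | zero => exact h₀
    | succ n ih => exact (hF n (s n) ih).1
  exact ⟨s, rfl, monotone_nat_of_le_succ fun n => (hF n (s n) (hs n)).2.1, hs,
    fun n => (hF n (s n) (hs n)).2.2⟩

section Homogeneity

variable {B U : Type u} [MetricSpace B] [MetricSpace U] [CompleteSpace U] {π : U → B}

/-- The partner of `v` must have distance `dist v x` from the partner of each `x`. The triangle
inequality in `X`, transported along `R`, makes this a Katetov function on the compact projection of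
`R`. -/
theorem IsUrysohnField.exists_insert (hπ : IsUrysohnField π) {X : Type*} [MetricSpace X]
    {φ : X → B} (hφ : LipschitzWith 1 φ) {R : Set (X × U)} (hR : IsCompact R)
    (h : IsPartialIsometry φ π R) (v : X) :
    ∃ w, IsPartialIsometry φ π (insert (v, w) R) := by
  classical
  -- The chosen partner is irrelevant: a partial isometry is injective, so `y` has at most one.
  let f : U → ℝ := fun y => if hy : ∃ x, (x, y) ∈ R then dist v hy.choose else 0
  have hf : ∀ p ∈ R, f p.2 = dist v p.1 := by
    intro p hp
    have hy : ∃ x, (x, p.2) ∈ R := ⟨p.1, hp⟩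
    have h1 := h.dist_eq _ hy.choose_spec _ hp
    simp only [dist_self] at h1
    simp only [f, dif_pos hy, dist_eq_zero.1 h1]
  obtain ⟨w, hw, hwb⟩ := hπ.exists_dist_eq_of_isCompact (hR.image continuous_snd)
    (f := f) (b := φ v) (by
      refine ⟨?_, ?_, ?_⟩
      · rintro _ ⟨p, hp, rfl⟩ _ ⟨q, hq, rfl⟩
        rw [hf p hp, hf q hq, ← h.dist_eq p hp q hq, dist_comm p.1]
        exact dist_triangle _ _ _
      · rintro _ ⟨p, hp, rfl⟩ _ ⟨q, hq, rfl⟩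
        rw [hf p hp, hf q hq, ← h.dist_eq p hp q hq]
        exact dist_triangle_left _ _ _
      · rintro _ ⟨p, hp, rfl⟩
        rw [hf p hp, ← h.comm p hp, dist_comm]
        simpa using hφ.dist_le_mul v p.1)
  have key : ∀ p ∈ R, dist v p.1 = dist w p.2 := fun p hp => by
    rw [hw _ (mem_image_of_mem _ hp), hf p hp]
  refine ⟨w, ?_, ?_⟩
  · rintro p (rfl | hp) q (rfl | hq)
    · simp
    · exact key q hq
    · rw [dist_comm, key p hp, dist_comm]
    · exact h.dist_eq p hp q hq
  · rintro p (rfl | hp)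
    · exact hwb.symm
    · exact h.comm p hp

/-- Separable spaces over `B` embed into a complete Urysohn field. -/
theorem IsUrysohnField.exists_embedding (hπ : IsUrysohnField π) {X : Type*} [MetricSpace X]
    [TopologicalSpace.SeparableSpace X] {φ : X → B} (hφ : LipschitzWith 1 φ) :
    ∃ ι : X → U, Isometry ι ∧ ∀ x, π (ι x) = φ x := by
  rcases isEmpty_or_nonempty X with hX | hX
  · exact ⟨fun x => isEmptyElim x, fun x => isEmptyElim x, fun x => isEmptyElim x⟩
  -- Only the forth half is needed, since the image need not be dense. The chain starts at the empty
  -- relation.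
  obtain ⟨R, -, hmono, hS, hG⟩ := exists_chain
    (S := fun R : Set (X × U) => IsCompact R ∧ IsPartialIsometry φ π R)
    (G := fun n R => TopologicalSpace.denseSeq X n ∈ Prod.fst '' R)
    (fun n R hR => by
      obtain ⟨w, hw⟩ := hπ.exists_insert hφ hR.1 hR.2 (TopologicalSpace.denseSeq X n)
      exact ⟨_, ⟨hR.1.insert _, hw⟩, subset_insert _ _, ⟨_, mem_insert _ _, rfl⟩⟩)
    (R₀ := ∅) ⟨isCompact_empty, by simp, by simp⟩
  have hP := IsPartialIsometry.iUnion (fun n => (hS n).2) hmono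
  have hd : Dense (Prod.fst '' ⋃ n, R n) := by
    refine (TopologicalSpace.denseRange_denseSeq X).mono ?_
    rintro _ ⟨n, rfl⟩
    exact image_mono (subset_iUnion R (n + 1)) (hG n)
  obtain ⟨g, hg, hgR⟩ := hP.exists_isometry hd
  refine ⟨g, hg, fun x => ?_⟩
  refine congrFun (Continuous.ext_on hd (hπ.lipschitz.continuous.comp hg.continuous)
    hφ.continuous ?_) x
  rintro _ ⟨p, hp, rfl⟩
  simp only [Function.comp, hgR p hp, hP.comm p hp]

/-- Compact homogeneity of a separable complete Urysohn field. -/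
theorem IsUrysohnField.exists_fieldAut [TopologicalSpace.SeparableSpace U]
    (hπ : IsUrysohnField π) {R₀ : Set (U × U)} (hR₀ : IsCompact R₀)
    (h₀ : IsPartialIsometry π π R₀) : ∃ g : fieldAut π, ∀ p ∈ R₀, g.1 p.1 = p.2 := by
  rcases isEmpty_or_nonempty U with hU | hU
  · exact ⟨1, fun p => isEmptyElim p.1⟩
  obtain ⟨R, hR0, hmono, hS, hG⟩ := exists_chain
    (S := fun R : Set (U × U) => IsCompact R ∧ IsPartialIsometry π π R)
    (G := fun n R => TopologicalSpace.denseSeq U n ∈ Prod.fst '' R ∧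
      TopologicalSpace.denseSeq U n ∈ Prod.snd '' R)
    (fun n R hR => by
      obtain ⟨w, hw⟩ := hπ.exists_insert hπ.lipschitz hR.1 hR.2 (TopologicalSpace.denseSeq U n)
      have hc := hR.1.insert (TopologicalSpace.denseSeq U n, w)
      have hc' : IsCompact (Prod.swap ⁻¹' insert (TopologicalSpace.denseSeq U n, w) R) :=
        (Homeomorph.prodComm U U).isCompact_preimage.2 hc
      obtain ⟨w', hw'⟩ := hπ.exists_insert hπ.lipschitz hc' hw.swap
        (TopologicalSpace.denseSeq U n)
      refine ⟨insert (w', TopologicalSpace.denseSeq U n)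
        (insert (TopologicalSpace.denseSeq U n, w) R), ⟨hc.insert _, ?_⟩,
        (subset_insert _ _).trans (subset_insert _ _),
        ⟨_, mem_insert_of_mem _ (mem_insert _ _), rfl⟩, ⟨_, mem_insert _ _, rfl⟩⟩
      convert hw'.swap using 1
      ext ⟨a, b⟩
      simp [and_comm])
    (R₀ := R₀) ⟨hR₀, h₀⟩
  have hP := IsPartialIsometry.iUnion (fun n => (hS n).2) hmono
  have hd : Dense (Prod.fst '' ⋃ n, R n) := by
    refine (TopologicalSpace.denseRange_denseSeq U).mono ?_
    rintro _ ⟨n, rfl⟩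
    exact image_mono (subset_iUnion R (n + 1)) (hG n).1
  have hd' : Dense (Prod.snd '' ⋃ n, R n) := by
    refine (TopologicalSpace.denseRange_denseSeq U).mono ?_
    rintro _ ⟨n, rfl⟩
    exact image_mono (subset_iUnion R (n + 1)) (hG n).2
  have hd'' : Dense (Prod.fst '' (Prod.swap ⁻¹' ⋃ n, R n)) := by
    convert hd' using 1
    ext x
    simp
  obtain ⟨g, hg, hgR⟩ := hP.exists_isometry hd
  obtain ⟨k, hk, hkR⟩ := hP.swap.exists_isometry hd''
  have hkR' : ∀ p ∈ ⋃ n, R n, k p.2 = p.1 := fun p hp => hkR p.swap (by simpa using hp)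
  -- A right inverse suffices because the isometry `g` is injective.
  have hgk : ∀ y, g (k y) = y := fun y => by
    refine congrFun (Continuous.ext_on hd' (hg.continuous.comp hk.continuous)
      continuous_id ?_) y
    rintro _ ⟨p, hp, rfl⟩
    simp only [Function.comp, hkR' p hp, hgR p hp, id]
  refine ⟨⟨IsometryEquiv.mk' g k hgk hg, fun x => ?_⟩, fun p hp => ?_⟩
  · refine congrFun (Continuous.ext_on hd (hπ.lipschitz.continuous.comp hg.continuous)
      hπ.lipschitz.continuous ?_) x
    rintro _ ⟨p, hp, rfl⟩
    simp only [Function.comp, hgR p hp, hP.comm p hp]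
  · exact hgR p (mem_iUnion.2 ⟨0, hR0 ▸ hp⟩)

end Homogeneity

end Geometry

/-! ### Couplings and the `∞`-Wasserstein distance. -/

section Coupling

open ProbabilityTheory

/-- The support is conull, and a conull closed set such as `{f ≤ r}` contains it. Suprema over
supports thus become almost-everywhere bounds, which pass through pushforwards and gluing. -/
theorem iSup_support_le_iff {X : Type*} [TopologicalSpace X] [SecondCountableTopology X]
    [MeasurableSpace X] {P : Measure X} {f : X → ℝ≥0∞} (hf : Continuous f) {r : ℝ≥0∞} :
    ⨆ z ∈ P.support, f z ≤ r ↔ ∀ᵐ z ∂P, f z ≤ r := by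
  constructor
  · intro h
    filter_upwards [Measure.support_mem_ae (μ := P)] with z hz
    exact (le_iSup₂ (f := fun z (_ : z ∈ P.support) => f z) z hz).trans h
  · intro h
    have := Measure.support_subset_of_isClosed (isClosed_le hf continuous_const) h
    exact iSup₂_le fun z hz => this hz

/-- Two couplings with a common marginal can be glued. -/
theorem exists_glue {X Y Z : Type*} [MeasurableSpace X] [StandardBorelSpace X] [Nonempty X]
    [MeasurableSpace Y] [MeasurableSpace Z] [StandardBorelSpace Z] [Nonempty Z]
    (P : Measure (X × Y)) (Q : Measure (Y × Z)) [IsFiniteMeasure P] [IsFiniteMeasure Q]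
    (h : P.map Prod.snd = Q.map Prod.fst) :
    ∃ T : Measure (X × Y × Z), T.map (fun t => (t.1, t.2.1)) = P ∧ T.map Prod.snd = Q := by
  -- The swap puts the common marginal first, so both couplings disintegrate over it.
  let P' := P.map Prod.swap
  have hP' : P'.fst = Q.fst := by
    simp only [P', Measure.fst]
    rw [Measure.map_map measurable_fst measurable_swap, ← h]
    rfl
  have h1 : Q.fst ⊗ₘ P'.condKernel = P' := by rw [← hP']; exact P'.disintegrate _
  have h2 : Q.fst ⊗ₘ Q.condKernel = Q := Q.disintegrate _
  -- The outer coordinates are made conditionally independent given the middle one.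
  let T := Q.fst ⊗ₘ (P'.condKernel ×ₖ Q.condKernel)
  have hT1 : T.map (Prod.map id Prod.fst) = P' := by
    rw [← Measure.compProd_map measurable_fst, ← Kernel.fst_eq, Kernel.fst_prod, h1]
  have hT2 : T.map (Prod.map id Prod.snd) = Q := by
    rw [← Measure.compProd_map measurable_snd, ← Kernel.snd_eq, Kernel.snd_prod, h2]
  refine ⟨T.map fun t => (t.2.1, t.1, t.2.2), ?_, ?_⟩
  · rw [Measure.map_map (by fun_prop) (by fun_prop)]
    have : P'.map Prod.swap = P := by
      rw [Measure.map_map measurable_swap measurable_swap, Prod.swap_swap_eq, Measure.map_id]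
    rw [← this, ← hT1, Measure.map_map measurable_swap (by fun_prop)]
    rfl
  · rw [Measure.map_map (by fun_prop) (by fun_prop)]
    exact hT2

variable {U : Type u} [MetricSpace U] [SecondCountableTopology U] [MeasurableSpace U]
  {μ ν ρ : Measure U}

theorem isProbabilityMeasure_of_mem_couplings {X Y : Type u} [MeasurableSpace X]
    [MeasurableSpace Y] {μ : Measure X} {ν : Measure Y} [IsProbabilityMeasure μ]
    {P : Measure (X × Y)} (hP : P ∈ couplings μ ν) : IsProbabilityMeasure P := by
  constructor
  rw [← preimage_univ (f := Prod.fst), ← Measure.map_apply measurable_fst .univ, hP.1]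
  exact measure_univ

theorem prod_mem_couplings {X Y : Type u} [MeasurableSpace X]
    [MeasurableSpace Y] (μ : Measure X) (ν : Measure Y) [IsProbabilityMeasure μ]
    [IsProbabilityMeasure ν] : μ.prod ν ∈ couplings μ ν :=
  ⟨by simp, by simp⟩

theorem dWInf_le {P : Measure (U × U)} (hP : P ∈ couplings μ ν) {r : ℝ≥0∞}
    (h : ∀ᵐ z ∂P, edist z.1 z.2 ≤ r) : dWInf μ ν ≤ r :=
  (iInf₂_le P hP).trans ((iSup_support_le_iff (by fun_prop)).2 h)

theorem exists_coupling_of_dWInf_lt {r : ℝ≥0∞} (h : dWInf μ ν < r) :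
    ∃ P ∈ couplings μ ν, ∀ᵐ z ∂P, edist z.1 z.2 ≤ r := by
  simp only [dWInf, iInf_lt_iff] at h
  obtain ⟨P, hP, hr⟩ := h
  exact ⟨P, hP, (iSup_support_le_iff (by fun_prop)).1 hr.le⟩

theorem dWInf_comm_le [OpensMeasurableSpace U] : dWInf ν μ ≤ dWInf μ ν := by
  refine le_of_forall_gt_imp_ge_of_dense fun r hr => ?_
  obtain ⟨P, hP, h⟩ := exists_coupling_of_dWInf_lt hr
  refine dWInf_le (P := P.map Prod.swap) ⟨?_, ?_⟩ ?_
  · rw [Measure.map_map measurable_fst measurable_swap]; exact hP.2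
  · rw [Measure.map_map measurable_snd measurable_swap]; exact hP.1
  · rw [ae_map_iff measurable_swap.aemeasurable
      (measurableSet_le measurable_edist measurable_const)]
    filter_upwards [h] with z hz
    rw [edist_comm]
    exact hz

theorem dWInf_comm [OpensMeasurableSpace U] : dWInf μ ν = dWInf ν μ :=
  le_antisymm dWInf_comm_le dWInf_comm_le

/-- The joint law of `f` and `g` is the coupling that witnesses the bound. -/
theorem dWInf_map_le [OpensMeasurableSpace U] {X : Type u} [MeasurableSpace X] {μ : Measure X}
    {f g : X → U} (hf : Measurable f) (hg : Measurable g) {r : ℝ≥0∞}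
    (h : ∀ᵐ x ∂μ, edist (f x) (g x) ≤ r) : dWInf (μ.map f) (μ.map g) ≤ r := by
  refine dWInf_le (P := μ.map fun x => (f x, g x)) ⟨?_, ?_⟩ ?_
  · rw [Measure.map_map measurable_fst (hf.prodMk hg)]; rfl
  · rw [Measure.map_map measurable_snd (hf.prodMk hg)]; rfl
  · rw [ae_map_iff (hf.prodMk hg).aemeasurable
      (measurableSet_le measurable_edist measurable_const)]
    exact h

theorem dWInf_map_map_le_of_coupling [OpensMeasurableSpace U] {X Y : Type u}
    [MeasurableSpace X] [MeasurableSpace Y] {μ : Measure X} {ν : Measure Y}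
    {P : Measure (X × Y)} (hP : P ∈ couplings μ ν)
    {f : X → U} {g : Y → U} (hf : Measurable f) (hg : Measurable g) {r : ℝ≥0∞}
    (h : ∀ᵐ z ∂P, edist (f z.1) (g z.2) ≤ r) : dWInf (μ.map f) (ν.map g) ≤ r := by
  rw [← hP.1, ← hP.2, Measure.map_map hf measurable_fst, Measure.map_map hg measurable_snd]
  exact dWInf_map_le (hf.comp measurable_fst) (hg.comp measurable_snd) h

theorem dWInf_self [OpensMeasurableSpace U] : dWInf μ μ = 0 := by
  refine nonpos_iff_eq_zero.1 ?_
  have := dWInf_map_le (μ := μ) measurable_id measurable_id (r := 0) (by simp)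
  rwa [Measure.map_id] at this

theorem dWInf_triangle [CompleteSpace U] [BorelSpace U] [IsProbabilityMeasure μ]
    [IsProbabilityMeasure ν] [IsProbabilityMeasure ρ] :
    dWInf μ ρ ≤ dWInf μ ν + dWInf ν ρ := by
  have hne : Nonempty U := nonempty_of_isProbabilityMeasure μ
  refine ENNReal.le_of_forall_pos_le_add fun ε hε hfin => ?_
  have hε' : (0 : ℝ≥0∞) < (ε / 2 : NNReal) := by exact_mod_cast half_pos hε
  have h12 := ENNReal.add_lt_top.1 hfin
  obtain ⟨P, hP, hPd⟩ := exists_coupling_of_dWInf_lt (ENNReal.lt_add_right h12.1.ne hε'.ne')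
  obtain ⟨Q, hQ, hQd⟩ := exists_coupling_of_dWInf_lt (ENNReal.lt_add_right h12.2.ne hε'.ne')
  have := isProbabilityMeasure_of_mem_couplings hP
  have := isProbabilityMeasure_of_mem_couplings hQ
  obtain ⟨T, hTP, hTQ⟩ := exists_glue P Q (hP.2.trans hQ.1.symm)
  have m1 : Measurable fun t : U × U × U => (t.1, t.2.1) := by fun_prop
  have h1 : T.map Prod.fst = μ := by
    rw [← hP.1, ← hTP, Measure.map_map measurable_fst m1]; rfl
  have h2 : T.map (fun t => t.2.2) = ρ := by
    rw [← hQ.2, ← hTQ, Measure.map_map measurable_snd measurable_snd]; rfl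
  rw [← hTP] at hPd
  rw [← hTQ] at hQd
  suffices dWInf (T.map Prod.fst) (T.map fun t => t.2.2) ≤ dWInf μ ν + dWInf ν ρ + ε by
    rwa [h1, h2] at this
  refine dWInf_map_le measurable_fst (by fun_prop) ?_
  filter_upwards [ae_of_ae_map m1.aemeasurable hPd,
    ae_of_ae_map measurable_snd.aemeasurable hQd] with t ht1 ht2
  refine (edist_triangle t.1 t.2.1 t.2.2).trans ((add_le_add ht1 ht2).trans (le_of_eq ?_))
  rw [add_add_add_comm, ← ENNReal.coe_add, add_halves]

/-- A coupling of cost at most `δ` carries `F` into its closed `δ`-thickening. As `δ → 0`, the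
measures of the thickenings decrease to that of the closed set `F`. -/
theorem measure_le_of_dWInf_eq_zero [BorelSpace U] [IsFiniteMeasure ν]
    (h : dWInf μ ν = 0) {F : Set U} (hF : IsClosed F) : μ F ≤ ν F := by
  have ht := (tendsto_measure_cthickening_of_isClosed (μ := ν) (s := F)
    ⟨1, one_pos, measure_ne_top _ _⟩ hF).mono_left (nhdsWithin_le_nhds (s := Ioi 0))
  refine ge_of_tendsto ht ?_
  filter_upwards [self_mem_nhdsWithin] with δ (hδ : 0 < δ)
  obtain ⟨P, hP, hPd⟩ := exists_coupling_of_dWInf_lt (h ▸ ENNReal.ofReal_pos.2 hδ)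
  rw [← hP.1, ← hP.2, Measure.map_apply measurable_fst hF.measurableSet,
    Measure.map_apply measurable_snd Metric.isClosed_cthickening.measurableSet]
  refine measure_mono_ae ?_
  filter_upwards [hPd] with z hz hzF
  refine Metric.mem_cthickening_of_edist_le z.2 z.1 δ F hzF ?_
  rwa [edist_comm]

theorem eq_of_dWInf_eq_zero [BorelSpace U] [IsProbabilityMeasure μ]
    [IsProbabilityMeasure ν] (h : dWInf μ ν = 0) : μ = ν := by
  refine ext_of_generate_finite _ ?_ isPiSystem_isClosed (fun F hF => ?_) (by simp)
  · rw [BorelSpace.measurable_eq (α := U), borel_eq_generateFrom_isClosed]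
  · exact le_antisymm (measure_le_of_dWInf_eq_zero h hF)
      (measure_le_of_dWInf_eq_zero (dWInf_comm.trans h) hF)

theorem dWInf_map_isometryEquiv_le [BorelSpace U] (g : U ≃ᵢ U) :
    dWInf (μ.map g) (ν.map g) ≤ dWInf μ ν := by
  refine le_of_forall_gt_imp_ge_of_dense fun r hr => ?_
  obtain ⟨P, hP, h⟩ := exists_coupling_of_dWInf_lt hr
  exact dWInf_map_map_le_of_coupling hP g.continuous.measurable g.continuous.measurable
    (by simpa only [g.edist_eq] using h)

/-- The product coupling costs at most the diameter of the union of the two supports. -/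
theorem dWInf_lt_top (hμ : IsCompact μ.support) (hν : IsCompact ν.support)
    [IsProbabilityMeasure μ] [IsProbabilityMeasure ν] : dWInf μ ν < ∞ := by
  have hb : Bornology.IsBounded (μ.support ∪ ν.support) := (hμ.union hν).isBounded
  refine lt_of_le_of_lt (dWInf_le (prod_mem_couplings μ ν) ?_) hb.ediam_ne_top.lt_top
  have h1 : ∀ᵐ z ∂μ.prod ν, z.1 ∈ μ.support :=
    Measure.quasiMeasurePreserving_fst.ae Measure.support_mem_ae
  have h2 : ∀ᵐ z ∂μ.prod ν, z.2 ∈ ν.support :=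
    Measure.quasiMeasurePreserving_snd.ae Measure.support_mem_ae
  filter_upwards [h1, h2] with z hz1 hz2
  exact Metric.edist_le_ediam_of_mem (Or.inl hz1) (Or.inr hz2)

end Coupling

attribute [local instance] UniformSpace.secondCountable_of_separable

/-- Pointwise convergent sequences of isometric embeddings of a compact set converge uniformly,
here along an arbitrary filter. -/
theorem eventually_dist_le_of_tendsto {U : Type*} [MetricSpace U] {l : Filter ℕ} {g : ℕ → U → U}
    (hg : ∀ n, Isometry (g n)) {K : Set U} (hK : IsCompact K) {h : U → U}
    (hh : ∀ x ∈ K, ∀ y ∈ K, dist (h x) (h y) = dist x y)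
    (hlim : ∀ x ∈ K, Tendsto (fun n => g n x) l (𝓝 (h x))) {δ : ℝ} (hδ : 0 < δ) :
    ∀ᶠ n in l, ∀ x ∈ K, dist (g n x) (h x) ≤ δ := by
  obtain ⟨A, hAK, hA, hcov⟩ := hK.finite_cover_balls (show 0 < δ / 3 by positivity)
  have : ∀ᶠ n in l, ∀ a ∈ A, dist (g n a) (h a) < δ / 3 := by
    rw [eventually_all_finite hA]
    intro a ha
    exact (hlim a (hAK ha)).eventually (Metric.ball_mem_nhds _ (by positivity))
  filter_upwards [this] with n hn x hx
  obtain ⟨a, ha, hxa⟩ := mem_iUnion₂.1 (hcov hx)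
  rw [Metric.mem_ball] at hxa
  have h1 := dist_triangle4 (g n x) (g n a) (h a) (h x)
  rw [(hg n).dist_eq, hh a (hAK ha) x hx, dist_comm a x] at h1
  linarith [hn a ha]

/-! ### The metric on the space of orbits. -/

section Orbits

set_option linter.unusedSectionVars false

variable {B U : Type u} [MetricSpace B] [MetricSpace U] [CompleteSpace U]
  [TopologicalSpace.SeparableSpace U] [MeasurableSpace U] [BorelSpace U] {π : U → B}

theorem CompactLaw.coe_smul (g : fieldAut π) (ν : CompactLaw U) :
    ((g • ν).1 : Measure U) = (ν.1 : Measure U).map g.1 := rfl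

theorem CompactLaw.ext {μ ν : CompactLaw U} (h : (μ.1 : Measure U) = ν.1) : μ = ν :=
  Subtype.ext (Subtype.ext h)

theorem LawOrbits.mk_eq_mk_iff {μ ν : CompactLaw U} :
    LawOrbits.mk π μ = LawOrbits.mk π ν ↔ ∃ g : fieldAut π, g • ν = μ := by
  refine (Quotient.eq (r := MulAction.orbitRel (fieldAut π) (CompactLaw U))).trans ?_
  rw [MulAction.orbitRel_apply, MulAction.mem_orbit_iff]

theorem LawOrbits.mk_smul (g : fieldAut π) (ν : CompactLaw U) :
    LawOrbits.mk π (g • ν) = LawOrbits.mk π ν :=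
  LawOrbits.mk_eq_mk_iff.2 ⟨g, rfl⟩

theorem LawOrbits.mk_surjective : Function.Surjective (LawOrbits.mk π) :=
  Quotient.exists_rep

theorem dWInf_smul_smul_le (g : fieldAut π) (μ ν : CompactLaw U) :
    dWInf ((g • μ).1 : Measure U) ((g • ν).1 : Measure U) ≤ dWInf (μ.1 : Measure U) ν.1 :=
  dWInf_map_isometryEquiv_le g.1

/-- The distance between two orbits of compactly supported laws. -/
def orbitEDist (π : U → B) (a b : LawOrbits π) : ℝ≥0∞ :=
  ⨅ (μ : CompactLaw U) (ν : CompactLaw U) (_ : LawOrbits.mk π μ = a) (_ : LawOrbits.mk π ν = b),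
    dWInf (μ.1 : Measure U) ν.1

theorem orbitEDist_mk_le (μ ν : CompactLaw U) :
    orbitEDist π (LawOrbits.mk π μ) (LawOrbits.mk π ν) ≤ dWInf (μ.1 : Measure U) ν.1 :=
  iInf_le_of_le μ <| iInf_le_of_le ν <| iInf_le_of_le rfl <| iInf_le_of_le rfl le_rfl

/-- By invariance under the diagonal action, one representative can be held fixed. -/
theorem orbitEDist_mk (μ ν : CompactLaw U) :
    orbitEDist π (LawOrbits.mk π μ) (LawOrbits.mk π ν) =
      ⨅ g : fieldAut π, dWInf (μ.1 : Measure U) ((g • ν).1 : Measure U) := by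
  apply le_antisymm
  · refine le_iInf fun g => ?_
    rw [← LawOrbits.mk_smul g ν]
    exact orbitEDist_mk_le _ _
  · refine le_iInf fun μ' => le_iInf fun ν' => le_iInf fun hμ => le_iInf fun hν => ?_
    obtain ⟨g, rfl⟩ := LawOrbits.mk_eq_mk_iff.1 hμ
    obtain ⟨k, rfl⟩ := LawOrbits.mk_eq_mk_iff.1 hν
    refine iInf_le_of_le (g⁻¹ * k) ?_
    have := dWInf_smul_smul_le g⁻¹ (g • μ) (k • ν)
    rwa [inv_smul_smul, ← mul_smul] at this

theorem orbitEDist_self (a : LawOrbits π) : orbitEDist π a a = 0 := by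
  obtain ⟨μ, rfl⟩ := LawOrbits.mk_surjective a
  exact nonpos_iff_eq_zero.1 ((orbitEDist_mk_le μ μ).trans dWInf_self.le)

theorem orbitEDist_comm (a b : LawOrbits π) : orbitEDist π a b = orbitEDist π b a := by
  have key : ∀ a b : LawOrbits π, orbitEDist π a b ≤ orbitEDist π b a := fun a b => by
    refine le_iInf fun μ => le_iInf fun ν => le_iInf fun hμ => le_iInf fun hν => ?_
    subst hμ hν
    rw [dWInf_comm]
    exact orbitEDist_mk_le _ _
  exact le_antisymm (key a b) (key b a)

theorem orbitEDist_triangle (a b c : LawOrbits π) :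
    orbitEDist π a c ≤ orbitEDist π a b + orbitEDist π b c := by
  obtain ⟨μ, rfl⟩ := LawOrbits.mk_surjective a
  obtain ⟨ν, rfl⟩ := LawOrbits.mk_surjective b
  obtain ⟨ρ, rfl⟩ := LawOrbits.mk_surjective c
  rw [orbitEDist_mk μ ν, orbitEDist_mk ν ρ]
  refine ENNReal.le_iInf_add_iInf fun g k => ?_
  rw [← LawOrbits.mk_smul (g * k) ρ]
  refine (orbitEDist_mk_le _ _).trans ?_
  refine (dWInf_triangle (ν := ((g • ν).1 : Measure U))).trans ?_
  gcongr
  rw [mul_smul]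
  exact dWInf_smul_smul_le g ν (k • ρ)

theorem orbitEDist_lt_top (a b : LawOrbits π) : orbitEDist π a b < ∞ := by
  obtain ⟨μ, rfl⟩ := LawOrbits.mk_surjective a
  obtain ⟨ν, rfl⟩ := LawOrbits.mk_surjective b
  exact (orbitEDist_mk_le μ ν).trans_lt (dWInf_lt_top μ.2 ν.2)

/-- The orbit distance is itself an admissible pseudo-metric, and every admissible one is bounded by
`dWInf` of each pair of representatives. -/
theorem orbitEDist_eq_quotientEDist (a b : LawOrbits π) :
    orbitEDist π a b =
      quotientEDist (fun μ ν : CompactLaw U => dWInf (μ.1 : Measure U) (ν.1 : Measure U))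
        (LawOrbits.mk π) a b := by
  apply le_antisymm
  · let m : PseudoEMetricSpace (LawOrbits π) :=
      { edist := orbitEDist π
        edist_self := orbitEDist_self
        edist_comm := orbitEDist_comm
        edist_triangle := orbitEDist_triangle }
    exact le_iSup₂_of_le (f := fun (m : PseudoEMetricSpace (LawOrbits π))
      (_ : ∀ x y : CompactLaw U, m.edist (LawOrbits.mk π x) (LawOrbits.mk π y) ≤
        dWInf (x.1 : Measure U) (y.1 : Measure U)) => m.edist a b) m orbitEDist_mk_le le_rfl
  · refine iSup₂_le fun m hm => ?_
    refine le_iInf fun μ => le_iInf fun ν => le_iInf fun hμ => le_iInf fun hν => ?_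
    subst hμ hν
    exact hm μ ν

/-- The closed `r`-neighbourhood of the support of `μ` is conull for `ν`, so it contains the support
of `ν`; compactness supplies a nearest point. -/
theorem exists_edist_le_of_mem_support {μ ν : Measure U} [IsProbabilityMeasure μ]
    (hμ : IsCompact μ.support) {r : ℝ≥0∞} (h : dWInf μ ν < r) {y : U} (hy : y ∈ ν.support) :
    ∃ x ∈ μ.support, edist y x ≤ r := by
  obtain ⟨P, hP, hPd⟩ := exists_coupling_of_dWInf_lt h
  have hcl : IsClosed {y | Metric.infEDist y μ.support ≤ r} :=
    isClosed_le Metric.continuous_infEDist continuous_const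
  have hsub : ν.support ⊆ {y | Metric.infEDist y μ.support ≤ r} := by
    refine Measure.support_subset_of_isClosed hcl ?_
    change ∀ᵐ y ∂ν, Metric.infEDist y μ.support ≤ r
    rw [← hP.2, ae_map_iff measurable_snd.aemeasurable hcl.measurableSet]
    have h1 : ∀ᵐ z ∂P, z.1 ∈ μ.support := by
      refine ae_of_ae_map measurable_fst.aemeasurable ?_
      rw [hP.1]
      exact Measure.support_mem_ae
    filter_upwards [h1, hPd] with z hz1 hz2
    refine (Metric.infEDist_le_edist_of_mem hz1).trans ?_
    rwa [edist_comm]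
  obtain ⟨x, hx, hxy⟩ := hμ.exists_infEDist_eq_edist
    (Measure.nonempty_support (IsProbabilityMeasure.ne_zero μ)) y
  exact ⟨x, hx, hxy ▸ hsub hy⟩

theorem eq_of_orbitEDist_eq_zero (hπ : IsUrysohnField π) {a b : LawOrbits π}
    (h : orbitEDist π a b = 0) : a = b := by
  obtain ⟨μ, rfl⟩ := LawOrbits.mk_surjective a
  obtain ⟨ν, rfl⟩ := LawOrbits.mk_surjective b
  rw [orbitEDist_mk] at h
  obtain ⟨ε, -, hε0, hε⟩ := exists_seq_strictAnti_tendsto' (show (0 : ℝ≥0∞) < 1 by simp)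
  have hex : ∀ n, ∃ g : fieldAut π, dWInf (μ.1 : Measure U) ((g • ν).1 : Measure U) < ε n :=
    fun n => iInf_lt_iff.1 (h ▸ (hε0 n).1)
  choose g hg using hex
  have hsupp : ∀ n, ∀ y ∈ (ν.1 : Measure U).support,
      (g n).1 y ∈ ((g n • ν).1 : Measure U).support := by
    intro n y hy
    rw [Measure.mem_support_iff_forall] at hy ⊢
    intro V hV
    rw [CompactLaw.coe_smul, ← IsometryEquiv.coe_toHomeomorph,
      ← Homeomorph.toMeasurableEquiv_coe, MeasurableEquiv.map_apply]
    exact hy _ ((g n).1.continuous.continuousAt hV)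
  -- The points `(g n).1 y` approach the compact support of `μ`, so they accumulate even though $U$
  -- need not be locally compact.
  have hnear : ∀ n, ∀ y : U, ∃ x, y ∈ (ν.1 : Measure U).support →
      x ∈ (μ.1 : Measure U).support ∧ edist ((g n).1 y) x ≤ ε n := by
    intro n y
    by_cases hy : y ∈ (ν.1 : Measure U).support
    · obtain ⟨x, hx⟩ := exists_edist_le_of_mem_support μ.2 (hg n) (hsupp n y hy)
      exact ⟨x, fun _ => hx⟩
    · exact ⟨y, fun h => absurd h hy⟩
  choose x hx using hnear
  -- One ultrafilter gives limits at all `y` simultaneously, with no diagonal subsequence.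
  let l : Ultrafilter ℕ := hyperfilter ℕ
  have hl : (l : Filter ℕ) ≤ atTop := Nat.hyperfilter_le_atTop
  have hlim : ∀ y, ∃ z, y ∈ (ν.1 : Measure U).support →
      Tendsto (fun n => (g n).1 y) l (𝓝 z) := by
    intro y
    by_cases hy : y ∈ (ν.1 : Measure U).support
    · obtain ⟨z, -, hz⟩ := μ.2.ultrafilter_le_nhds (l.map fun n => x n y)
        (le_principal_iff.2 <| show ∀ᶠ n in (l : Filter ℕ), x n y ∈ _ from
          .of_forall fun n => (hx n y hy).1)
      refine ⟨z, fun _ => ?_⟩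
      have hz' : Tendsto (fun n => x n y) l (𝓝 z) := hz
      rw [tendsto_iff_edist_tendsto_0] at hz' ⊢
      have h0 : Tendsto (fun n => ε n + edist (x n y) z) l (𝓝 (0 + 0)) :=
        (hε.mono_left hl).add hz'
      rw [add_zero] at h0
      exact tendsto_of_tendsto_of_tendsto_of_le_of_le tendsto_const_nhds h0
        (fun _ => zero_le) fun n =>
          (edist_triangle _ (x n y) _).trans (add_le_add_left (hx n y hy).2 _)
    · exact ⟨y, fun h => absurd h hy⟩
  choose f hf using hlim
  have hfdist : ∀ y ∈ (ν.1 : Measure U).support, ∀ z ∈ (ν.1 : Measure U).support,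
      dist (f y) (f z) = dist y z := fun y hy z hz =>
    tendsto_nhds_unique ((hf y hy).dist (hf z hz))
      (by simp only [IsometryEquiv.dist_eq]; exact tendsto_const_nhds)
  have hfproj : ∀ y ∈ (ν.1 : Measure U).support, π (f y) = π y := fun y hy =>
    tendsto_nhds_unique ((hπ.lipschitz.continuous.tendsto _).comp (hf y hy))
      (tendsto_const_nhds.congr fun n => ((g n).2 y).symm)
  have hfc : ContinuousOn f (ν.1 : Measure U).support := by
    refine LipschitzOnWith.continuousOn (K := 1) (LipschitzOnWith.of_dist_le_mul ?_)
    intro y hy z hz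
    simp [hfdist y hy z hz]
  -- The limit `f` is an isometry over $B$ only on the support of `ν`; homogeneity extends it from
  -- there.
  obtain ⟨k, hk⟩ := hπ.exists_fieldAut
    (R₀ := (fun y => (y, f y)) '' (ν.1 : Measure U).support)
    (ν.2.image_of_continuousOn (continuousOn_id.prodMk hfc))
    ⟨by
      rintro _ ⟨y, hy, rfl⟩ _ ⟨z, hz, rfl⟩
      exact (hfdist y hy z hz).symm,
    by
      rintro _ ⟨y, hy, rfl⟩
      exact (hfproj y hy).symm⟩
  have hkf : ∀ y ∈ (ν.1 : Measure U).support, k.1 y = f y := fun y hy =>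
    hk _ (mem_image_of_mem _ hy)
  refine LawOrbits.mk_eq_mk_iff.2 ⟨k, CompactLaw.ext (Eq.symm (eq_of_dWInf_eq_zero ?_))⟩
  refine nonpos_iff_eq_zero.1 (ENNReal.le_of_forall_pos_le_add fun δ hδ _ => ?_)
  rw [zero_add]
  have hev := eventually_dist_le_of_tendsto (l := l) (g := fun n => (g n).1)
    (fun n => (g n).1.isometry) ν.2 hfdist hf (half_pos (NNReal.coe_pos.2 hδ))
  have hεδ : ∀ᶠ n in (l : Filter ℕ), ε n < (δ / 2 : NNReal) :=
    (hε.mono_left hl).eventually (gt_mem_nhds (by exact_mod_cast half_pos hδ))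
  obtain ⟨n, hn1, hn2⟩ := (hev.and hεδ).exists
  have h1 : dWInf ((g n • ν).1 : Measure U) ((k • ν).1 : Measure U) ≤ (δ / 2 : NNReal) := by
    refine dWInf_map_le (g n).1.continuous.measurable k.1.continuous.measurable ?_
    filter_upwards [Measure.support_mem_ae (μ := (ν.1 : Measure U))] with y hy
    rw [hkf y hy, edist_nndist, ENNReal.coe_le_coe, ← NNReal.coe_le_coe, coe_nndist]
    simpa using hn1 y hy
  refine (dWInf_triangle (ν := ((g n • ν).1 : Measure U))).trans ?_
  refine (add_le_add ((hg n).le.trans hn2.le) h1).trans (le_of_eq ?_)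
  rw [← ENNReal.coe_add, add_halves]

end Orbits

theorem mem_support_prod {X Y : Type*} [TopologicalSpace X] [MeasurableSpace X]
    [TopologicalSpace Y] [MeasurableSpace Y] {P : Measure X} {Q : Measure Y} [SFinite P]
    [SFinite Q] {x : X} {y : Y} (hx : x ∈ P.support) (hy : y ∈ Q.support) :
    (x, y) ∈ (P.prod Q).support := by
  rw [Measure.mem_support_iff_forall] at *
  intro V hV
  obtain ⟨v, hv, w, hw, hvw⟩ := mem_nhds_prod_iff.1 hV
  refine lt_of_lt_of_le ?_ (measure_mono hvw)
  rw [Measure.prod_prod]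
  exact ENNReal.mul_pos (hx v hv).ne' (hy w hw).ne'

theorem mem_support_map {X Y : Type*} [TopologicalSpace X] [MeasurableSpace X]
    [TopologicalSpace Y] [MeasurableSpace Y] [OpensMeasurableSpace X] [BorelSpace Y]
    {μ : Measure X} {f : X → Y} (hf : Continuous f) {x : X} (hx : x ∈ μ.support) :
    f x ∈ (μ.map f).support := by
  rw [Measure.mem_support_iff_forall] at *
  intro V hV
  exact (hx _ (hf.continuousAt hV)).trans_le (Measure.le_map_apply hf.aemeasurable V)

theorem support_map_eq_range {X Y : Type*} [TopologicalSpace X] [CompactSpace X]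
    [MeasurableSpace X] [TopologicalSpace Y] [T2Space Y] [MeasurableSpace Y]
    [OpensMeasurableSpace X] [BorelSpace Y] {μ : Measure X} (hμ : μ.support = univ) {f : X → Y}
    (hf : Continuous f) : (μ.map f).support = range f := by
  apply Subset.antisymm
  · have hc : IsClosed (range f) := (isCompact_range hf).isClosed
    refine Measure.support_subset_of_isClosed hc ?_
    exact (ae_map_iff hf.aemeasurable hc.measurableSet).2 (.of_forall fun x => mem_range_self x)
  · rintro _ ⟨x, rfl⟩
    exact mem_support_map hf (hμ ▸ mem_univ x)

/-! ### Embedded laws and the comparison of the two distances. -/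

section Fields

set_option linter.unusedSectionVars false

variable {B U : Type u} [MetricSpace B] [MetricSpace U] [CompleteSpace U]
  [TopologicalSpace.SeparableSpace U] [MeasurableSpace U] [BorelSpace U] {π : U → B}

theorem IsUrysohnField.exists_isFieldEmbedding (hπ : IsUrysohnField π) (X : MMField B) :
    ∃ ι, IsFieldEmbedding X π ι := by
  obtain ⟨ι, h1, h2⟩ := hπ.exists_embedding X.lipschitz_proj
  exact ⟨ι, h1, h2⟩

theorem IsFieldEmbedding.smul {X : MMField B} {κ : X.carrier → U}
    (hκ : IsFieldEmbedding X π κ) (g : fieldAut π) : IsFieldEmbedding X π (g.1 ∘ κ) :=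
  ⟨g.1.isometry.comp hκ.isometry, fun x => (g.2 (κ x)).trans (hκ.comm x)⟩

theorem coe_embeddedLaw (X : CompactMMField B) {ι : X.1.carrier → U}
    (hι : IsFieldEmbedding X.1 π ι) :
    ((embeddedLaw X π ι hι).1 : Measure U) = (X.1.law : Measure X.1.carrier).map ι := rfl

theorem embeddedLaw_smul (X : CompactMMField B) {κ : X.1.carrier → U}
    (hκ : IsFieldEmbedding X.1 π κ) (g : fieldAut π) :
    embeddedLaw X π (g.1 ∘ κ) (hκ.smul g) = g • embeddedLaw X π κ hκ := by
  apply CompactLaw.ext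
  rw [CompactLaw.coe_smul, coe_embeddedLaw, coe_embeddedLaw,
    Measure.map_map g.1.continuous.measurable hκ.isometry.continuous.measurable]

/-- The orbit of the embedded law does not depend on the embedding. -/
theorem IsUrysohnField.mk_embeddedLaw_eq (hπ : IsUrysohnField π) (X : CompactMMField B)
    {ι κ : X.1.carrier → U} (hι : IsFieldEmbedding X.1 π ι) (hκ : IsFieldEmbedding X.1 π κ) :
    LawOrbits.mk π (embeddedLaw X π ι hι) = LawOrbits.mk π (embeddedLaw X π κ hκ) := by
  have := X.2
  obtain ⟨g, hg⟩ := hπ.exists_fieldAut (R₀ := range fun x => (κ x, ι x))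
    (isCompact_range (hκ.isometry.continuous.prodMk hι.isometry.continuous))
    ⟨by
      rintro _ ⟨x, rfl⟩ _ ⟨y, rfl⟩
      exact (hκ.isometry.dist_eq x y).trans (hι.isometry.dist_eq x y).symm,
    by
      rintro _ ⟨x, rfl⟩
      exact (hκ.comm x).trans (hι.comm x).symm⟩
  refine LawOrbits.mk_eq_mk_iff.2 ⟨g, ?_⟩
  rw [← embeddedLaw_smul]
  congr 1
  funext x
  exact hg _ (mem_range_self x)

/-- If `ι x`, `κ y` and `ι x'`, `κ y'` are `r`-close, the distances `dist x x'` and `dist y y'`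
differ by at most `2 r`, which the factor `1/2` absorbs. The projections are `r`-close because `π`
is $1$-Lipschitz. -/
theorem dGWInf_le_dWInf {X Y : MMField B} {ι : X.carrier → U} {κ : Y.carrier → U}
    (hι : IsFieldEmbedding X π ι) (hκ : IsFieldEmbedding Y π κ) (hπ : LipschitzWith 1 π) :
    dGWInf X Y ≤ dWInf ((X.law : Measure X.carrier).map ι) ((Y.law : Measure Y.carrier).map κ) := by
  have hX : Nonempty X.carrier := nonempty_of_isProbabilityMeasure (X.law : Measure X.carrier)
  have hY : Nonempty Y.carrier := nonempty_of_isProbabilityMeasure (Y.law : Measure Y.carrier)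
  have hmι := hι.isometry.isClosedEmbedding.measurableEmbedding
  have hmκ := hκ.isometry.isClosedEmbedding.measurableEmbedding
  -- Measurable left inverses of `ι` and `κ` pull couplings back; their values off the ranges do not
  -- matter, since those sets are null.
  obtain ⟨p, hp, hpι⟩ := hmι.exists_measurable_extend measurable_id fun _ => hX
  obtain ⟨q, hq, hqκ⟩ := hmκ.exists_measurable_extend measurable_id fun _ => hY
  refine le_of_forall_gt_imp_ge_of_dense fun r hr => ?_
  obtain ⟨Q, hQ, hQd⟩ := exists_coupling_of_dWInf_lt hr
  have hpq : Measurable (Prod.map p q) := hp.prodMap hq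
  have hP : Q.map (Prod.map p q) ∈ couplings (X.law : Measure X.carrier) Y.law := by
    constructor
    · have h1 : (Q.map Prod.fst).map p = X.law := by
        rw [hQ.1, Measure.map_map hp hmι.measurable, hpι, Measure.map_id]
      rw [Measure.map_map measurable_fst hpq, ← h1, Measure.map_map hp measurable_fst]
      rfl
    · have h1 : (Q.map Prod.snd).map q = Y.law := by
        rw [hQ.2, Measure.map_map hq hmκ.measurable, hqκ, Measure.map_id]
      rw [Measure.map_map measurable_snd hpq, ← h1, Measure.map_map hq measurable_snd]
      rfl
  have := isProbabilityMeasure_of_mem_couplings hP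
  have hd : ∀ᵐ z ∂Q.map (Prod.map p q), edist (ι z.1) (κ z.2) ≤ r := by
    have hm : Measurable fun z : X.carrier × Y.carrier => edist (ι z.1) (κ z.2) :=
      (hmι.measurable.comp measurable_fst).edist (hmκ.measurable.comp measurable_snd)
    rw [ae_map_iff hpq.aemeasurable (measurableSet_le hm measurable_const)]
    have h1 : ∀ᵐ z ∂Q, z.1 ∈ range ι := by
      refine ae_of_ae_map measurable_fst.aemeasurable ?_
      rw [hQ.1]
      exact (ae_map_iff hmι.measurable.aemeasurable hmι.measurableSet_range).2
        (.of_forall fun x => mem_range_self x)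
    have h2 : ∀ᵐ z ∂Q, z.2 ∈ range κ := by
      refine ae_of_ae_map measurable_snd.aemeasurable ?_
      rw [hQ.2]
      exact (ae_map_iff hmκ.measurable.aemeasurable hmκ.measurableSet_range).2
        (.of_forall fun x => mem_range_self x)
    filter_upwards [hQd, h1, h2] with z hz hz1 hz2
    obtain ⟨u, v⟩ := z
    obtain ⟨x, rfl⟩ := hz1
    obtain ⟨y, rfl⟩ := hz2
    have hx : p (ι x) = x := congrFun hpι x
    have hy : q (κ y) = y := congrFun hqκ y
    simpa only [Prod.map_apply, hx, hy] using hz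
  refine (iInf₂_le _ hP).trans (max_le ?_ ?_)
  · refine ENNReal.div_le_of_le_mul ((iSup_support_le_iff
      (ENNReal.continuous_ofReal.comp (by fun_prop))).2 ?_)
    filter_upwards [Measure.quasiMeasurePreserving_fst.ae hd,
      Measure.quasiMeasurePreserving_snd.ae hd] with z hz1 hz2
    rw [mul_two]
    refine le_trans ?_ (add_le_add hz1 hz2)
    rw [edist_dist, edist_dist, ← ENNReal.ofReal_add dist_nonneg dist_nonneg]
    refine ENNReal.ofReal_le_ofReal ?_
    beta_reduce
    rw [← hι.isometry.dist_eq, ← hκ.isometry.dist_eq]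
    have h := dist_dist_dist_le (ι z.1.1) (ι z.2.1) (κ z.1.2) (κ z.2.2)
    rwa [Real.dist_eq] at h
  · refine (iSup_support_le_iff
      ((X.lipschitz_proj.continuous.comp continuous_fst).edist
        (Y.lipschitz_proj.continuous.comp continuous_snd))).2 ?_
    filter_upwards [hd] with z hz
    rw [Function.comp, Function.comp, ← hι.comm, ← hκ.comm]
    refine le_trans ?_ hz
    simpa using hπ.edist_le_mul (ι z.1) (κ z.2)

/-- If a relation `S` distorts distances by at most `2 r` and projections by at most `r`, then
both spaces embed over `B` with related points at distance at most `r`. -/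
theorem IsUrysohnField.exists_embeddings_dist_le (hπ : IsUrysohnField π) {X Y : MMField B}
    {S : Set (X.carrier × Y.carrier)} (hS : S.Nonempty) {r : ℝ} (hr : 0 < r)
    (h1 : ∀ z ∈ S, ∀ w ∈ S, |dist z.1 w.1 - dist z.2 w.2| ≤ 2 * r)
    (h2 : ∀ z ∈ S, dist (X.proj z.1) (Y.proj z.2) ≤ r) :
    ∃ (ι : X.carrier → U) (κ : Y.carrier → U), IsFieldEmbedding X π ι ∧
      IsFieldEmbedding Y π κ ∧ ∀ z ∈ S, dist (ι z.1) (κ z.2) ≤ r := by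
  have : Nonempty S := hS.to_subtype
  -- A path from `x` to `y` crosses at some pair of `S`, at cost `r`. Positivity of `r` keeps the
  -- two parts apart.
  let m : MetricSpace (X.carrier ⊕ Y.carrier) :=
    Metric.glueMetricApprox (fun z : S => z.1.1) (fun z : S => z.1.2) r hr
      fun z w => h1 z z.2 w w.2
  have hX : Isometry (Sum.inl : X.carrier → X.carrier ⊕ Y.carrier) :=
    Isometry.of_dist_eq fun _ _ => rfl
  have hY : Isometry (Sum.inr : Y.carrier → X.carrier ⊕ Y.carrier) :=
    Isometry.of_dist_eq fun _ _ => rfl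
  have : TopologicalSpace.SeparableSpace (X.carrier ⊕ Y.carrier) := by
    have h := (TopologicalSpace.IsSeparable.of_separableSpace (univ : Set X.carrier)).image
      hX.continuous |>.union <|
      (TopologicalSpace.IsSeparable.of_separableSpace (univ : Set Y.carrier)).image hY.continuous
    rw [image_univ, image_univ, range_inl_union_range_inr] at h
    exact TopologicalSpace.isSeparable_univ_iff.1 h
  have hXY : ∀ x y, dist (X.proj x) (Y.proj y) ≤
      dist (Sum.inl x : X.carrier ⊕ Y.carrier) (Sum.inr y) := by
    intro x y
    change _ ≤ (⨅ p : S, dist x p.1.1 + dist y p.1.2) + r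
    rw [← sub_le_iff_le_add]
    refine le_ciInf fun p => ?_
    have e1 : dist (X.proj x) (X.proj p.1.1) ≤ dist x p.1.1 := by
      simpa using X.lipschitz_proj.dist_le_mul x p.1.1
    have e2 : dist (Y.proj y) (Y.proj p.1.2) ≤ dist y p.1.2 := by
      simpa using Y.lipschitz_proj.dist_le_mul y p.1.2
    have e3 := h2 p.1 p.2
    have e4 := dist_triangle4 (X.proj x) (X.proj p.1.1) (Y.proj p.1.2) (Y.proj y)
    rw [dist_comm (Y.proj p.1.2)] at e4
    linarith
  have hφ : LipschitzWith 1 (Sum.elim X.proj Y.proj) := by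
    refine LipschitzWith.of_dist_le_mul ?_
    rw [NNReal.coe_one]
    rintro (x | x) (y | y) <;> simp only [one_mul, Sum.elim_inl, Sum.elim_inr]
    · rw [hX.dist_eq]
      simpa using X.lipschitz_proj.dist_le_mul x y
    · exact hXY x y
    · rw [dist_comm, dist_comm (Sum.inr x)]
      exact hXY y x
    · rw [hY.dist_eq]
      simpa using Y.lipschitz_proj.dist_le_mul x y
  obtain ⟨j, hj, hjφ⟩ := hπ.exists_embedding hφ
  refine ⟨j ∘ Sum.inl, j ∘ Sum.inr, ⟨hj.comp hX, fun x => hjφ _⟩, ⟨hj.comp hY, fun x => hjφ _⟩,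
    fun z hz => ?_⟩
  rw [Function.comp, Function.comp, hj.dist_eq]
  exact (Metric.glueDist_glued_points (fun z : S => z.1.1) (fun z : S => z.1.2) r ⟨z, hz⟩).le

theorem IsUrysohnField.orbitEDist_le_dGWInf (hπ : IsUrysohnField π) (X Y : CompactMMField B)
    {ι : X.1.carrier → U} {κ : Y.1.carrier → U} (hι : IsFieldEmbedding X.1 π ι)
    (hκ : IsFieldEmbedding Y.1 π κ) :
    orbitEDist π (LawOrbits.mk π (embeddedLaw X π ι hι))
      (LawOrbits.mk π (embeddedLaw Y π κ hκ)) ≤ dGWInf X.1 Y.1 := by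
  refine le_of_forall_gt_imp_ge_of_dense fun r hr => ?_
  rcases eq_or_ne r ∞ with rfl | hr'
  · exact le_top
  lift r to NNReal using hr'
  have hr0 : 0 < (r : ℝ) := by exact_mod_cast pos_of_gt hr
  simp only [dGWInf, iInf_lt_iff] at hr
  obtain ⟨P, hP, hr⟩ := hr
  obtain ⟨hr1, hr2⟩ := max_lt_iff.1 hr
  have := isProbabilityMeasure_of_mem_couplings hP
  rw [ENNReal.div_lt_iff (by simp) (by simp)] at hr1
  obtain ⟨ι', κ', hι', hκ', hd⟩ := hπ.exists_embeddings_dist_le (S := P.support)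
    (Measure.nonempty_support (IsProbabilityMeasure.ne_zero P)) hr0
    (fun z hz w hw => by
      -- Any two points of `P.support` form a point of the support of `P.prod P`, so the distortion
      -- bound holds for every such pair.
      have h := (le_iSup₂ (f := fun (z : (X.1.carrier × Y.1.carrier) × X.1.carrier × Y.1.carrier)
        (_ : z ∈ (P.prod P).support) => ENNReal.ofReal |dist z.1.1 z.2.1 - dist z.1.2 z.2.2|)
        (z, w) (mem_support_prod hz hw)).trans hr1.le
      rw [← ENNReal.ofReal_coe_nnreal, ← ENNReal.ofReal_ofNat, ← ENNReal.ofReal_mul r.coe_nonneg,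
        ENNReal.ofReal_le_ofReal_iff (by positivity), mul_comm] at h
      exact h)
    (fun z hz => by
      have h := (le_iSup₂ (f := fun (z : X.1.carrier × Y.1.carrier) (_ : z ∈ P.support) =>
        edist (X.1.proj z.1) (Y.1.proj z.2)) z hz).trans hr2.le
      rwa [edist_nndist, ENNReal.coe_le_coe, ← NNReal.coe_le_coe, coe_nndist] at h)
  -- The orbits do not change when the given embeddings are replaced by those from the gluing.
  rw [hπ.mk_embeddedLaw_eq X hι hι', hπ.mk_embeddedLaw_eq Y hκ hκ']
  refine (orbitEDist_mk_le _ _).trans ?_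
  refine dWInf_map_map_le_of_coupling hP hι'.isometry.continuous.measurable
    hκ'.isometry.continuous.measurable ?_
  filter_upwards [Measure.support_mem_ae (μ := P)] with z hz
  rw [edist_nndist, ENNReal.coe_le_coe, ← NNReal.coe_le_coe, coe_nndist]
  exact hd z hz

theorem IsUrysohnField.orbitEDist_eq_dGWInf (hπ : IsUrysohnField π) (X Y : CompactMMField B)
    {ι : X.1.carrier → U} {κ : Y.1.carrier → U} (hι : IsFieldEmbedding X.1 π ι)
    (hκ : IsFieldEmbedding Y.1 π κ) :
    orbitEDist π (LawOrbits.mk π (embeddedLaw X π ι hι))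
      (LawOrbits.mk π (embeddedLaw Y π κ hκ)) = dGWInf X.1 Y.1 := by
  refine le_antisymm (hπ.orbitEDist_le_dGWInf X Y hι hκ) ?_
  rw [orbitEDist_mk]
  refine le_iInf fun g => ?_
  rw [← embeddedLaw_smul]
  exact dGWInf_le_dWInf hι (hκ.smul g) hπ.lipschitz

theorem MMField.Isometric.mk_embeddedLaw_eq (hπ : IsUrysohnField π) {X Y : CompactMMField B}
    (h : X.1.Isometric Y.1) {ι : X.1.carrier → U} {κ : Y.1.carrier → U}
    (hι : IsFieldEmbedding X.1 π ι) (hκ : IsFieldEmbedding Y.1 π κ) :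
    LawOrbits.mk π (embeddedLaw X π ι hι) = LawOrbits.mk π (embeddedLaw Y π κ hκ) := by
  obtain ⟨e, he, heμ⟩ := h
  have hκe : IsFieldEmbedding X.1 π (κ ∘ e) :=
    ⟨hκ.isometry.comp e.isometry, fun x => (hκ.comm _).trans (he x)⟩
  rw [hπ.mk_embeddedLaw_eq X hι hκe]
  congr 1
  apply CompactLaw.ext
  rw [coe_embeddedLaw, coe_embeddedLaw, ← heμ,
    Measure.map_map hκ.isometry.continuous.measurable e.continuous.measurable]

/-- Fully supported fields whose embedded laws lie in the same orbit are isometric. -/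
theorem isometric_of_mk_embeddedLaw_eq {X Y : CompactMMField B}
    (hX : (X.1.law : Measure X.1.carrier).support = univ)
    (hY : (Y.1.law : Measure Y.1.carrier).support = univ)
    {ι : X.1.carrier → U} {κ : Y.1.carrier → U}
    (hι : IsFieldEmbedding X.1 π ι) (hκ : IsFieldEmbedding Y.1 π κ)
    (h : LawOrbits.mk π (embeddedLaw X π ι hι) = LawOrbits.mk π (embeddedLaw Y π κ hκ)) :
    X.1.Isometric Y.1 := by
  have := X.2
  have := Y.2
  obtain ⟨g, hg⟩ := LawOrbits.mk_eq_mk_iff.1 h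
  rw [← embeddedLaw_smul] at hg
  obtain ⟨k, hκ', hg⟩ : ∃ (k : Y.1.carrier → U) (hk : IsFieldEmbedding Y.1 π k),
      embeddedLaw Y π k hk = embeddedLaw X π ι hι := ⟨_, hκ.smul g, hg⟩
  have hlaw : (Y.1.law : Measure Y.1.carrier).map k = (X.1.law : Measure X.1.carrier).map ι :=
    congrArg (fun μ : CompactLaw U => (μ.1 : Measure U)) hg
  -- Full support lets each image be recovered as the support of the common law, so the two images
  -- coincide.
  have hrange : range k = range ι := by
    rw [← support_map_eq_range hX hι.isometry.continuous, ← hlaw,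
      support_map_eq_range hY hκ'.isometry.continuous]
  have h1 : ∀ x, ∃ y, k y = ι x := fun x => by
    rw [← mem_range, hrange]
    exact mem_range_self x
  have h2 : ∀ y, ∃ x, ι x = k y := fun y => by
    rw [← mem_range, ← hrange]
    exact mem_range_self y
  choose e he using h1
  choose f hf using h2
  have hei : Isometry e := Isometry.of_dist_eq fun x x' => by
    rw [← hκ'.isometry.dist_eq, he, he, hι.isometry.dist_eq]
  refine ⟨IsometryEquiv.mk' e f (fun y => hκ'.isometry.injective (by rw [he, hf])) hei,
    fun x => ?_, ?_⟩
  · change Y.1.proj (e x) = _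
    rw [← hκ'.comm, he, hι.comm]
  · change Measure.map e _ = _
    have hmk := hκ'.isometry.isClosedEmbedding.measurableEmbedding
    rw [← hmk.comap_map (Measure.map e _), ← hmk.comap_map (Y.1.law : Measure Y.1.carrier), hlaw,
      Measure.map_map hmk.measurable hei.continuous.measurable]
    congr 2
    exact funext he

/-- Every compactly supported law is the embedded law of a fully supported field. -/
theorem exists_embeddedLaw_eq (hπ : LipschitzWith 1 π) (ν : CompactLaw U) :
    ∃ (X : CompactMMField B) (ι : X.1.carrier → U) (hι : IsFieldEmbedding X.1 π ι),
      (X.1.law : Measure X.1.carrier).support = univ ∧ embeddedLaw X π ι hι = ν := by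
  let K := (ν.1 : Measure U).support
  have hK : IsCompact K := ν.2
  have hKc : CompactSpace K := isCompact_iff_compactSpace.1 hK
  have hmK := MeasurableEmbedding.subtype_coe (s := K) hK.isClosed.measurableSet
  have hmap : ((ν.1 : Measure U).comap ((↑) : K → U)).map ((↑) : K → U) = ν.1 := by
    rw [hmK.map_comap, Subtype.range_coe]
    exact Measure.restrict_eq_self_of_ae_mem Measure.support_mem_ae
  have hprob : IsProbabilityMeasure ((ν.1 : Measure U).comap ((↑) : K → U)) := by
    constructor
    rw [← preimage_univ (f := ((↑) : K → U)), ← Measure.map_apply hmK.measurable .univ, hmap]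
    exact measure_univ
  let X : MMField B :=
    { carrier := K
      proj := fun x => π x
      lipschitz_proj := fun x y => hπ x y
      law := ⟨(ν.1 : Measure U).comap ((↑) : K → U), hprob⟩ }
  refine ⟨⟨X, hKc⟩, ((↑) : K → U), ⟨isometry_subtype_coe, fun _ => rfl⟩, ?_, CompactLaw.ext hmap⟩
  change ((ν.1 : Measure U).comap ((↑) : K → U)).support = univ
  refine eq_univ_of_forall fun x => ?_
  rw [Measure.mem_support_iff_forall]
  intro V hV
  -- A neighbourhood in `K` contains the trace of an open set of $U$ around a support point, which
  -- has positive mass.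
  obtain ⟨W, hW, hWV⟩ := mem_nhds_subtype K x V |>.1 hV
  obtain ⟨W', hW'W, hW'o, hxW'⟩ := mem_nhds_iff.1 hW
  have hpos := (Measure.mem_support_iff_forall x.1).1 x.2 W' (hW'o.mem_nhds hxW')
  rw [← hmap, Measure.map_apply hmK.measurable hW'o.measurableSet] at hpos
  exact hpos.trans_le (measure_mono ((preimage_mono hW'W).trans hWV))

/-- The metric on the space of orbits of compactly supported laws. -/
@[reducible] def IsUrysohnField.metricSpaceLawOrbits (hπ : IsUrysohnField π) :
    MetricSpace (LawOrbits π) :=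
  let _ : EMetricSpace (LawOrbits π) :=
    { edist := orbitEDist π
      edist_self := orbitEDist_self
      edist_comm := orbitEDist_comm
      edist_triangle := orbitEDist_triangle
      eq_of_edist_eq_zero := eq_of_orbitEDist_eq_zero hπ }
  EMetricSpace.toMetricSpace fun a b => (orbitEDist_lt_top a b).ne

/-- The orbit of the law of a compact field embedded into a Urysohn field. -/
def IsUrysohnField.toLawOrbits (hπ : IsUrysohnField π) : Moduli B → LawOrbits π :=
  Quotient.lift (fun X : CompactMMField B => LawOrbits.mk π
    (embeddedLaw X π (hπ.exists_isFieldEmbedding X.1).choose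
      (hπ.exists_isFieldEmbedding X.1).choose_spec))
    fun _ _ h => MMField.Isometric.mk_embeddedLaw_eq hπ h _ _

theorem IsUrysohnField.toLawOrbits_mk (hπ : IsUrysohnField π) (X : CompactMMField B)
    {ι : X.1.carrier → U} (hι : IsFieldEmbedding X.1 π ι) :
    hπ.toLawOrbits (Moduli.mk X) = LawOrbits.mk π (embeddedLaw X π ι hι) :=
  hπ.mk_embeddedLaw_eq X _ hι

theorem IsUrysohnField.exists_fullySupported_toLawOrbits_eq (hπ : IsUrysohnField π)
    (a : LawOrbits π) : ∃ c ∈ fullySupportedModuli B, hπ.toLawOrbits c = a := by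
  obtain ⟨ν, rfl⟩ := LawOrbits.mk_surjective a
  obtain ⟨X, ι, hι, hX, rfl⟩ := exists_embeddedLaw_eq hπ.lipschitz ν
  exact ⟨Moduli.mk X, ⟨X, hX, rfl⟩, hπ.toLawOrbits_mk X hι⟩

theorem IsUrysohnField.injOn_toLawOrbits (hπ : IsUrysohnField π) :
    InjOn hπ.toLawOrbits (fullySupportedModuli B) := by
  rintro _ ⟨X, hX, rfl⟩ _ ⟨Y, hY, rfl⟩ h
  exact Quotient.sound (s := compactMMFieldSetoid B) (isometric_of_mk_embeddedLaw_eq hX hY _ _ h)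

end Fields

theorem mainTheorem10 {B U : Type u}
    [MetricSpace B] [CompleteSpace B] [TopologicalSpace.SeparableSpace B]
    [MetricSpace U] [CompleteSpace U] [TopologicalSpace.SeparableSpace U]
    [MeasurableSpace U] [BorelSpace U] (π : U → B) (hπ : IsUrysohnField π) :
    ∃ (_ : PseudoMetricSpace (Moduli B)) (_ : MetricSpace (LawOrbits π)),
      -- the distance between isometry classes is the Gromov-Wasserstein distance
      (∀ X Y : CompactMMField B, edist (Moduli.mk X) (Moduli.mk Y) = dGWInf X.1 Y.1) ∧
      -- the distance on the orbit space is the quotient metric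
      (∀ a b : LawOrbits π, edist a b =
        quotientEDist (fun μ ν : CompactLaw U => dWInf (μ.1 : Measure U) (ν.1 : Measure U))
          (LawOrbits.mk π) a b) ∧
      -- its explicit expression
      (∀ μ ν : CompactLaw U, edist (LawOrbits.mk π μ) (LawOrbits.mk π ν) =
        ⨅ g : fieldAut π, dWInf (μ.1 : Measure U) ((g • ν).1 : Measure U)) ∧
      -- every compact field embeds, and embedding it induces the isometry
      (∀ X : CompactMMField B, ∃ ι, IsFieldEmbedding X.1 π ι) ∧
      ∃ Ψ : Moduli B → LawOrbits π,
        (∀ (X : CompactMMField B) (ι : X.1.carrier → U) (hι : IsFieldEmbedding X.1 π ι),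
          Ψ (Moduli.mk X) = LawOrbits.mk π (embeddedLaw X π ι hι)) ∧
        Isometry Ψ ∧ Function.Surjective Ψ ∧
        ∃ Φ : fullySupportedModuli B ≃ᵢ LawOrbits π, ∀ c, Φ c = Ψ c := by
  let m : MetricSpace (LawOrbits π) := hπ.metricSpaceLawOrbits
  -- Pulling the metric back along $\Psi$ makes the axioms and the isometry automatic; the content
  -- lies in identifying it with `dGWInf`.
  let m' : PseudoMetricSpace (Moduli B) := m.toPseudoMetricSpace.induced hπ.toLawOrbits
  have hΨ : Isometry hπ.toLawOrbits := fun _ _ => rfl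
  refine ⟨m', m, fun X Y => ?_, orbitEDist_eq_quotientEDist, orbitEDist_mk,
    fun X => hπ.exists_isFieldEmbedding X.1, hπ.toLawOrbits, fun X ι hι => hπ.toLawOrbits_mk X hι,
    hΨ, fun a => ?_, ⟨Equiv.ofBijective (fun c => hπ.toLawOrbits c.1)
      ⟨fun c c' h => Subtype.ext (hπ.injOn_toLawOrbits c.2 c'.2 h), fun a => ?_⟩,
      fun _ _ => rfl⟩, fun _ => rfl⟩
  · exact hπ.orbitEDist_eq_dGWInf X Y _ _
  · obtain ⟨c, -, hc⟩ := hπ.exists_fullySupported_toLawOrbits_eq a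
    exact ⟨c, hc⟩
  · obtain ⟨c, hc, hca⟩ := hπ.exists_fullySupported_toLawOrbits_eq a
    exact ⟨⟨c, hc⟩, hca⟩

end
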